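/- Let $F$ be a free group of finite rank $k$ with a fixed free basis $\Sigma$, and let $A=\Sigma\cup\Sigma^{-1}$; elements of $F$ are identified with freely reduced words in $A$, and $|v|$ is the length of the word $v$. The cyclically reduced length $\|v\|$ is the length of the word obtained by cyclically reducing $v$. Let $\partial F$ be the boundary of $F$ (right-infinite freely reduced words, with the topology generated by the cylinders $\mathrm{Cyl}(v)$ of rays starting with $v\in F$). Let $\partial^2F=\{(x,y)\in(\partial F)^2: x\neq y\}$, identified with the oriented bi-infinite geodesics of the Cayley graph of $F$ with respect to $A$. Let $B\subset\partial^2F$ be the set of geodesics passing through the vertex $1$, and for $x\neq y$ in $F$ let $\mathrm{Cyl}([x,y])\subset\partial^2F$ be the set of geodesics passing through $x$ and then through $y$. The uniform measure $\mu_A$ is the Borel probability measure on $\partial F$ with $\mu_A(\mathrm{Cyl}(v))=\frac{1}{2k(2k-1)^{|v|-1}}$ for all $v\neq1$. The uniform current $\eta_A$ is the Borel measure on $\partial^2F$ with $\eta_A(\mathrm{Cyl}([x,y]))=\mu_A(\mathrm{Cyl}(x^{-1}y))$ for all $x\neq y$ in $F$ (if $k=0$, then $\partial F=\emptyset$ and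 both measures are zero). Every automorphism $\Phi$ of $F$ extends to a homeomorphism of $\partial F$, still denoted by $\Phi$. The length of $\Phi$ is $$L(\Phi)=\big((\Phi\times\Phi)_*\eta_A\big)(B).$$ Let $(\Phi_n)_{n\in\mathbb N}$ be a sequence of automorphisms of $F$. If there is a real number $M$ such that $L(\Phi_n)<M$ for all $n$, then for each $f\in F$ there is a number $M(f)$ such that $\|\Phi_n(f)\|<M(f)$ for all $n$. -/

import Mathlib

open MeasureTheory Filter
open scoped ENNReal NNReal

namespace FreeGroupCurrent

section Boundary

variable {α : Type*}

/-- The boundary at infinity of the free group on `α`: right-infinite freely reduced words.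
A letter `(a, true)` stands for `a`, and `(a, false)` for `a⁻¹`. -/
@[ext]
structure Boundary (α : Type*) where
  letter : ℕ → α × Bool
  reduced : ∀ n, (letter n).1 = (letter (n + 1)).1 → (letter n).2 = (letter (n + 1)).2

/-- The initial segment of length `n` of a ray. -/
def Boundary.initial (ξ : Boundary α) (n : ℕ) : List (α × Bool) :=
  (List.range n).map ξ.letter

/-- The rays whose initial segment is the word `w`. -/
def wordCylinder (w : List (α × Bool)) : Set (Boundary α) :=
  {ξ | ξ.initial w.length = w}

/-- The topology of the boundary, generated by the cylinders. -/
instance : TopologicalSpace (Boundary α) :=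
  TopologicalSpace.generateFrom (Set.range wordCylinder)

instance : MeasurableSpace (Boundary α) := borel _

instance : BorelSpace (Boundary α) := ⟨rfl⟩

instance [Countable α] : SecondCountableTopology (Boundary α) :=
  ⟨⟨Set.range wordCylinder, Set.countable_range _, rfl⟩⟩

/-- The cylinder of an element `v` of the free group: the rays that start with the reduced
word of `v`. -/
def cylinder [DecidableEq α] (v : FreeGroup α) : Set (Boundary α) :=
  wordCylinder v.toWord

/-- The space of pairs of distinct boundary points, that is, of oriented bi-infinite geodesics
of the Cayley graph. -/
abbrev DoubleBoundary (α : Type*) : Type _ :=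
  {p : Boundary α × Boundary α // p.1 ≠ p.2}

/-- A sequence of elements of the free group converges to a boundary point `ξ` if every initial
segment of `ξ` is an initial segment of all but finitely many of its reduced words. -/
def ConvergesTo [DecidableEq α] (g : ℕ → FreeGroup α) (ξ : Boundary α) : Prop :=
  ∀ m, ∀ᶠ n in atTop, ξ.initial m <+: (g n).toWord

/-- `γ` is a geodesic line of the Cayley graph going from `ξ` to `ζ`; the distance of two
vertices `x`, `y` is the length of the reduced word of `x⁻¹ * y`. -/
structure IsGeodesicLine [DecidableEq α] (γ : ℤ → FreeGroup α) (ξ ζ : Boundary α) : Prop where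
  isometry : ∀ i j, (((γ i)⁻¹ * γ j).norm : ℤ) = |i - j|
  left : ConvergesTo (fun n : ℕ => γ (-n)) ξ
  right : ConvergesTo (fun n : ℕ => γ n) ζ

/-- The cylinder of the oriented segment `[x, y]`: the geodesics that pass through `x` and then
through `y` (for `x = y`, the geodesics that pass through `x`). -/
def segmentCylinder [DecidableEq α] (x y : FreeGroup α) : Set (DoubleBoundary α) :=
  {p | ∃ γ : ℤ → FreeGroup α, IsGeodesicLine γ p.1.1 p.1.2 ∧ ∃ i j, i ≤ j ∧ γ i = x ∧ γ j = y}

/-- The base-ball: the geodesics that pass through the vertex `1`. -/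
def baseBall [DecidableEq α] : Set (DoubleBoundary α) := segmentCylinder 1 1

end Boundary

section Words

variable {α : Type*}

theorem isOpen_wordCylinder (w : List (α × Bool)) : IsOpen (wordCylinder w) :=
  TopologicalSpace.isOpen_generateFrom_of_mem ⟨w, rfl⟩

theorem Boundary.length_initial (ξ : Boundary α) (n : ℕ) : (ξ.initial n).length = n := by
  simp [initial]

theorem Boundary.initial_succ (ξ : Boundary α) (n : ℕ) :
    ξ.initial (n + 1) = ξ.initial n ++ [ξ.letter n] := by
  simp [initial, List.range_succ]

theorem Boundary.take_initial (ξ : Boundary α) {m n : ℕ} (h : m ≤ n) :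
    (ξ.initial n).take m = ξ.initial m := by
  simp [initial, ← List.map_take, List.take_range, h]

theorem Boundary.initial_prefix (ξ : Boundary α) {m n : ℕ} (h : m ≤ n) :
    ξ.initial m <+: ξ.initial n := by
  rw [← ξ.take_initial h]
  exact List.take_prefix _ _

theorem Boundary.isReduced_initial (ξ : Boundary α) (n : ℕ) :
    FreeGroup.IsReduced (ξ.initial n) := by
  rw [FreeGroup.IsReduced, List.isChain_iff_getElem]
  intro i hi
  simpa [initial] using ξ.reduced i

theorem Boundary.ext_initial {ξ ζ : Boundary α} (h : ∀ n, ξ.initial n = ζ.initial n) :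
    ξ = ζ := by
  refine Boundary.ext (funext fun n => ?_)
  have := h (n + 1)
  rw [initial_succ, initial_succ, h n] at this
  simpa using this

theorem exists_boundary (e : ℕ → List (α × Bool)) (hl : ∀ n, (e n).length = n)
    (hp : ∀ n, e n <+: e (n + 1)) (hr : ∀ n, FreeGroup.IsReduced (e n)) :
    ∃ ξ : Boundary α, ∀ n, ξ.initial n = e n := by
  have h1 : ∀ n, ∃ a, e (n + 1) = e n ++ [a] := by
    intro n
    obtain ⟨t, ht⟩ := hp n
    have : t.length = 1 := by
      have := congrArg List.length ht
      simp [hl] at this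
      omega
    obtain ⟨a, rfl⟩ := List.length_eq_one_iff.1 this
    exact ⟨a, ht.symm⟩
  choose x hx using h1
  have hx' : ∀ n, (x n).1 = (x (n + 1)).1 → (x n).2 = (x (n + 1)).2 := by
    intro n
    have := hr (n + 2)
    rw [hx, hx, List.append_assoc, FreeGroup.IsReduced] at this
    have h2 := (List.isChain_append.1 this).2.1
    simpa using h2
  let ξ : Boundary α := ⟨x, hx'⟩
  refine ⟨ξ, fun n => ?_⟩
  · induction n with
    | zero => simpa [Boundary.initial] using (List.length_eq_zero_iff.1 (hl 0)).symm
    | succ n ih => rw [Boundary.initial_succ, ih, hx n]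

variable [DecidableEq α]

theorem toWord_mk_of_isReduced {L : List (α × Bool)} (h : FreeGroup.IsReduced L) :
    (FreeGroup.mk L).toWord = L := by
  rw [FreeGroup.toWord_mk, h.reduce_eq]

theorem mul_letter (h : FreeGroup α) (a : α × Bool) :
    (h * FreeGroup.mk [a]).toWord = h.toWord ++ [a] ∨
      h.toWord = (h * FreeGroup.mk [a]).toWord ++ [(a.1, !a.2)] := by
  by_cases hr : FreeGroup.IsReduced (h.toWord ++ [a])
  · left
    rw [FreeGroup.toWord_mul, toWord_mk_of_isReduced (by simp), hr.reduce_eq]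
  · right
    rcases List.eq_nil_or_concat h.toWord with h0 | ⟨l, b, hb⟩
    · simp [h0] at hr
    · rw [List.concat_eq_append] at hb
      have hh : FreeGroup.IsReduced h.toWord := FreeGroup.isReduced_toWord
      have hl : FreeGroup.IsReduced l := by
        rw [hb] at hh
        exact (List.isChain_append.1 hh).1
      have hba : b = (a.1, !a.2) := by
        rw [FreeGroup.IsReduced, List.isChain_append] at hr
        simp only [hb] at hr hh
        have : ¬ (b.1 = a.1 → b.2 = a.2) := by
          intro h3
          refine hr ⟨hh, by simp, ?_⟩
          simpa using h3
        push Not at this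
        ext
        · exact this.1
        · have := this.2
          revert this
          cases b.2 <;> cases a.2 <;> simp
      have : h * FreeGroup.mk [a] = FreeGroup.mk l := by
        rw [← FreeGroup.mk_toWord (x := h), hb, hba, FreeGroup.mul_mk]
        refine FreeGroup.reduce.exact (FreeGroup.reduce.Step.eq ?_)
        simpa using FreeGroup.Red.Step.not (L₁ := l) (L₂ := []) (x := a.1) (b := !a.2)
      rw [this, toWord_mk_of_isReduced hl, hb, hba]

theorem take_mul (c : List (α × Bool)) : ∀ (h : FreeGroup α) (r : ℕ), r + c.length ≤ h.norm →
    (h * FreeGroup.mk c).toWord.take r = h.toWord.take r := by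
  induction c with
  | nil =>
    intro h r _
    rw [← FreeGroup.one_eq_mk, mul_one]
  | cons a c ih =>
    intro h r hr
    have e : h * FreeGroup.mk (a :: c) = h * FreeGroup.mk [a] * FreeGroup.mk c := by
      rw [mul_assoc, FreeGroup.mul_mk]
      rfl
    simp only [List.length_cons] at hr
    rw [e]
    rcases mul_letter h a with h1 | h1
    · rw [ih _ _ (by rw [FreeGroup.norm, h1]; simp; rw [FreeGroup.norm] at hr; omega), h1,
        List.take_append_of_le_length (by rw [FreeGroup.norm] at hr; omega)]
    · have h2 : h.norm = (h * FreeGroup.mk [a]).norm + 1 := by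
        simpa [FreeGroup.norm] using congrArg List.length h1
      rw [ih _ _ (by omega), h1,
        List.take_append_of_le_length (by rw [FreeGroup.norm, FreeGroup.norm] at h2; rw [FreeGroup.norm] at hr; omega)]

theorem take_mul' (h c : FreeGroup α) {r : ℕ} (hr : r + c.norm ≤ h.norm) :
    (h * c).toWord.take r = h.toWord.take r := by
  have := take_mul c.toWord h r hr
  rwa [FreeGroup.mk_toWord] at this

theorem exists_norm_le [Finite α] (Φ : FreeGroup α →* FreeGroup α) :
    ∃ C, 1 ≤ C ∧ ∀ g, (Φ g).norm ≤ C * g.norm := by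
  obtain ⟨C, hC⟩ := (Set.finite_range fun a : α × Bool => (Φ (FreeGroup.mk [a])).norm).bddAbove
  have key : ∀ L : List (α × Bool), (Φ (FreeGroup.mk L)).norm ≤ (C + 1) * L.length := by
    intro L
    induction L with
    | nil => simp [← FreeGroup.one_eq_mk]
    | cons a L ih =>
      have e : FreeGroup.mk (a :: L) = FreeGroup.mk [a] * FreeGroup.mk L := by
        rw [FreeGroup.mul_mk]
        rfl
      rw [e, map_mul]
      have h1 := FreeGroup.norm_mul_le (Φ (FreeGroup.mk [a])) (Φ (FreeGroup.mk L))
      have h2 : (Φ (FreeGroup.mk [a])).norm ≤ C := hC ⟨a, rfl⟩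
      simp only [List.length_cons, mul_add]
      omega
  refine ⟨C + 1, by omega, fun g => ?_⟩
  have := key g.toWord
  rwa [FreeGroup.mk_toWord] at this

theorem take_map [Finite α] (Φ : FreeGroup α ≃* FreeGroup α) (r : ℕ) :
    ∃ m, ∀ w g : FreeGroup α, m ≤ w.norm → w.toWord <+: g.toWord →
      r ≤ (Φ w).norm ∧ (Φ g).toWord.take r = (Φ w).toWord.take r := by
  obtain ⟨C, hC1, hC⟩ := exists_norm_le Φ.toMonoidHom
  obtain ⟨D, hD1, hD⟩ := exists_norm_le Φ.symm.toMonoidHom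
  have low : ∀ w : FreeGroup α, D * (r + C) ≤ w.norm → r + C ≤ (Φ w).norm := by
    intro w hw
    have := hD (Φ w)
    simp only [MulEquiv.coe_toMonoidHom, MulEquiv.symm_apply_apply] at this
    exact Nat.le_of_mul_le_mul_left (hw.trans this) (by omega)
  refine ⟨D * (r + C), fun w g hw hwg => ⟨by have := low w hw; omega, ?_⟩⟩
  have key : ∀ t : List (α × Bool), FreeGroup.IsReduced (w.toWord ++ t) →
      (Φ (FreeGroup.mk (w.toWord ++ t))).toWord.take r = (Φ w).toWord.take r := by
    intro t
    induction t using List.reverseRecOn with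
    | nil => simp [FreeGroup.mk_toWord]
    | append_singleton t a ih =>
      intro ht
      rw [← List.append_assoc] at ht ⊢
      have ht' := (List.isChain_append.1 ht).1
      rw [← ih ht', ← FreeGroup.mul_mk, map_mul]
      refine take_mul' _ _ ?_
      have h1 := hC (FreeGroup.mk [a])
      have h2 : (FreeGroup.mk [a]).norm = 1 := by
        rw [FreeGroup.norm, toWord_mk_of_isReduced (by simp)]; rfl
      have h3 := low (FreeGroup.mk (w.toWord ++ t)) (by
        rw [FreeGroup.norm, toWord_mk_of_isReduced ht', List.length_append]
        exact hw.trans (Nat.le_add_right _ _))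
      rw [h2, mul_one] at h1
      simp only [MulEquiv.coe_toMonoidHom] at h1
      omega
  obtain ⟨t, ht⟩ := hwg
  have := key t (by rw [ht]; exact FreeGroup.isReduced_toWord)
  rwa [ht, FreeGroup.mk_toWord] at this

theorem ConvergesTo.unique {g : ℕ → FreeGroup α} {ξ ζ : Boundary α} (h1 : ConvergesTo g ξ)
    (h2 : ConvergesTo g ζ) : ξ = ζ := by
  refine Boundary.ext_initial fun m => ?_
  obtain ⟨n, hn1, hn2⟩ := ((h1 m).and (h2 m)).exists
  exact (List.prefix_of_prefix_length_le hn1 hn2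
    (by simp [Boundary.length_initial])).eq_of_length (by simp [Boundary.length_initial])

theorem toWord_vertex (ξ : Boundary α) (n : ℕ) :
    (FreeGroup.mk (ξ.initial n)).toWord = ξ.initial n :=
  toWord_mk_of_isReduced (ξ.isReduced_initial n)

theorem convergesTo_vertex (ξ : Boundary α) :
    ConvergesTo (fun n => FreeGroup.mk (ξ.initial n)) ξ := by
  intro m
  filter_upwards [eventually_ge_atTop m] with n hn
  rw [toWord_vertex]
  exact ξ.initial_prefix hn

/-- An automorphism extends to the boundary. -/
theorem exists_boundary_limit [Finite α] (Φ : FreeGroup α ≃* FreeGroup α) (ξ : Boundary α) :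
    ∃ ζ : Boundary α, ∀ g, ConvergesTo g ξ → ConvergesTo (fun n => Φ (g n)) ζ := by
  choose m hm using take_map Φ
  let v : ℕ → FreeGroup α := fun n => FreeGroup.mk (ξ.initial n)
  have hvn : ∀ n, (v n).norm = n := fun n => by
    simp only [v, FreeGroup.norm, toWord_vertex, Boundary.length_initial]
  have hvp : ∀ i j, i ≤ j → (v i).toWord <+: (v j).toWord := fun i j hij => by
    simp only [v, toWord_vertex]
    exact ξ.initial_prefix hij
  let e : ℕ → List (α × Bool) := fun r => (Φ (v (m r))).toWord.take r
  have he : ∀ r n, m r ≤ n → (Φ (v n)).toWord.take r = e r := fun r n hn =>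
    (hm r (v (m r)) (v n) (by rw [hvn]) (hvp _ _ hn)).2
  have hlen : ∀ r, (e r).length = r := fun r => by
    have := (hm r (v (m r)) (v (m r)) (by rw [hvn]) (hvp _ _ le_rfl)).1
    simpa [e, FreeGroup.norm] using this
  obtain ⟨ζ, hζ⟩ := exists_boundary e hlen
    (fun r => by
      rw [← he r (max (m r) (m (r + 1))) (le_max_left _ _),
        ← he (r + 1) (max (m r) (m (r + 1))) (le_max_right _ _)]
      exact List.take_prefix_take_left (Nat.le_succ r))
    (fun r => List.IsChain.take FreeGroup.isReduced_toWord r)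
  refine ⟨ζ, fun g hg r => ?_⟩
  filter_upwards [hg (m r)] with n hn
  have := (hm r (v (m r)) (g n) (by rw [hvn]) (by simpa only [v, toWord_vertex] using hn)).2
  rw [hζ, show e r = (Φ (g n)).toWord.take r from this.symm]
  exact List.take_prefix _ _

end Words

section Action

variable {α : Type*} [DecidableEq α] [Finite α]

/-- The extension of an automorphism to the boundary: `Φ (g n) → boundaryMap Φ ξ` whenever
`g n → ξ`. -/
noncomputable def boundaryMap (Φ : FreeGroup α ≃* FreeGroup α) (ξ : Boundary α) : Boundary α :=
  (exists_boundary_limit Φ ξ).choose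

theorem boundaryMap_spec (Φ : FreeGroup α ≃* FreeGroup α) {g : ℕ → FreeGroup α} {ξ : Boundary α}
    (h : ConvergesTo g ξ) : ConvergesTo (fun n => Φ (g n)) (boundaryMap Φ ξ) :=
  (exists_boundary_limit Φ ξ).choose_spec g h

theorem boundaryMap_symm (Φ : FreeGroup α ≃* FreeGroup α) (ξ : Boundary α) :
    boundaryMap Φ.symm (boundaryMap Φ ξ) = ξ := by
  have h := boundaryMap_spec Φ.symm (boundaryMap_spec Φ (convergesTo_vertex ξ))
  simp only [MulEquiv.symm_apply_apply] at h
  exact h.unique (convergesTo_vertex ξ)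

theorem boundaryMap_injective (Φ : FreeGroup α ≃* FreeGroup α) :
    Function.Injective (boundaryMap Φ) :=
  Function.LeftInverse.injective (boundaryMap_symm Φ)

theorem continuous_boundaryMap (Φ : FreeGroup α ≃* FreeGroup α) :
    Continuous (boundaryMap Φ) := by
  refine continuous_generateFrom_iff.2 ?_
  rintro _ ⟨w, rfl⟩
  obtain ⟨m, hm⟩ := take_map Φ w.length
  refine isOpen_iff_forall_mem_open.2 fun ξ hξ =>
    ⟨wordCylinder (ξ.initial m), ?_, isOpen_wordCylinder _, by
      simp [wordCylinder, Boundary.length_initial]⟩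
  have key : ∀ ζ ∈ wordCylinder (ξ.initial m), (boundaryMap Φ ζ).initial w.length =
      (Φ (FreeGroup.mk (ξ.initial m))).toWord.take w.length := by
    intro ζ hζ
    obtain ⟨n, hn1, hn2⟩ := ((boundaryMap_spec Φ (convergesTo_vertex ζ) w.length).and
      (eventually_ge_atTop m)).exists
    have h1 := (hm (FreeGroup.mk (ξ.initial m)) (FreeGroup.mk (ζ.initial n))
      (by rw [FreeGroup.norm, toWord_vertex, Boundary.length_initial]) (by
        rw [toWord_vertex, toWord_vertex]
        have : ζ.initial m = ξ.initial m := by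
          simpa [wordCylinder, Boundary.length_initial] using hζ
        rw [← this]
        exact ζ.initial_prefix hn2)).2
    rw [← h1]
    have := List.prefix_iff_eq_take.1 hn1
    rw [Boundary.length_initial] at this
    exact this
  intro ζ hζ
  have h1 := key ζ hζ
  have h2 := key ξ (by simp [wordCylinder, Boundary.length_initial])
  have h3 : (boundaryMap Φ ξ).initial w.length = w := hξ
  show (boundaryMap Φ ζ).initial w.length = w
  rw [h1, ← h2, h3]

/-- The action of an automorphism on pairs of distinct boundary points. -/
noncomputable def doubleBoundaryMap (Φ : FreeGroup α ≃* FreeGroup α) (p : DoubleBoundary α) :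
    DoubleBoundary α :=
  ⟨(boundaryMap Φ p.1.1, boundaryMap Φ p.1.2), fun h => p.2 (boundaryMap_injective Φ h)⟩

theorem measurable_doubleBoundaryMap (Φ : FreeGroup α ≃* FreeGroup α) :
    Measurable (doubleBoundaryMap Φ) := by
  have := (continuous_boundaryMap Φ).measurable
  exact Measurable.subtype_mk (by fun_prop)

end Action

section UniformMeasure

variable {α : Type*}

/-- The first letter of a ray. -/
structure FirstLetter (α : Type*) where
  letter : α × Bool

instance : MeasurableSpace (FirstLetter α) := ⊤

/-- The letters that may follow the letter `a` in a freely reduced word. -/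
@[ext]
structure NextLetter (a : α × Bool) where
  letter : α × Bool
  reduced : a.1 = letter.1 → a.2 = letter.2

instance (a : α × Bool) : MeasurableSpace (NextLetter a) := ⊤

instance : DiscreteMeasurableSpace (FirstLetter α) := ⟨fun _ => trivial⟩

instance (a : α × Bool) : DiscreteMeasurableSpace (NextLetter a) := ⟨fun _ => trivial⟩

instance (a : α × Bool) : Nonempty (NextLetter a) := ⟨⟨a, fun _ => rfl⟩⟩

/-- The letters of the path that starts with `a` and after the letter number `n`, if that is `b`,
continues with the letter `s (n, b)`. -/
def path (a : α × Bool) (s : ∀ i : ℕ × (α × Bool), NextLetter i.2) : ℕ → α × Bool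
  | 0 => a
  | n + 1 => (s (n, path a s n)).letter

/-- The ray followed by the path. -/
def pathRay (z : FirstLetter α × (∀ i : ℕ × (α × Bool), NextLetter i.2)) : Boundary α :=
  ⟨path z.1.letter z.2, fun n => (z.2 (n, path z.1.letter z.2 n)).reduced⟩

instance [Finite α] : Finite (FirstLetter α) := 
  Finite.of_injective FirstLetter.letter fun ⟨_⟩ ⟨_⟩ h => congrArg FirstLetter.mk h

instance [Finite α] (a : α × Bool) : Finite (NextLetter a) :=
  Finite.of_injective NextLetter.letter fun _ _ h => NextLetter.ext h

/-- The uniform measure on the boundary: the law of the ray whose first letter is uniformly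
distributed among all letters, and each of whose next letters is, independently, uniformly
distributed among the letters that are not the inverse of the last one. -/
noncomputable def uniformMeasure (α : Type*) [Finite α] : Measure (Boundary α) :=
  ((ProbabilityTheory.uniformOn (Set.univ : Set (FirstLetter α))).prod
    (Measure.infinitePi fun i : ℕ × (α × Bool) =>
      ProbabilityTheory.uniformOn (Set.univ : Set (NextLetter i.2)))).map pathRay

theorem pathRay_preimage (ζ : Boundary α) (n : ℕ) [DecidableEq α] :
    pathRay ⁻¹' wordCylinder (ζ.initial (n + 1)) = ({⟨ζ.letter 0⟩} : Set (FirstLetter α)) ×ˢ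
      Set.pi ((Finset.range n).image fun i => (i, ζ.letter i) : Finset (ℕ × (α × Bool)))
        (fun i : ℕ × (α × Bool) => {c : NextLetter i.2 | c.letter = ζ.letter (i.1 + 1)}) := by
  ext ⟨⟨a⟩, s⟩
  simp only [wordCylinder, Set.mem_preimage, Set.mem_ofPred_eq, 
    Boundary.initial, List.length_map, List.length_range, List.map_inj_left, List.mem_range, Set.mem_prod, Set.mem_singleton_iff, FirstLetter.mk.injEq,
    Set.mem_pi, Finset.coe_image, Set.mem_image, Finset.coe_range, Set.mem_Iio,
    forall_exists_index, and_imp]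
  constructor
  · intro h
    refine ⟨h 0 (by omega), ?_⟩
    rintro _ i hi rfl
    have h1 := h i (by omega)
    have h2 := h (i + 1) (by omega)
    simp only [pathRay, path] at h1 h2 ⊢
    rw [← h2, h1]
  · rintro ⟨h0, h⟩ i
    induction i with
    | zero => intro _; exact h0
    | succ i ih =>
      intro hi
      have h1 := ih (by omega)
      have h2 := h _ i (by omega) rfl
      simp only [pathRay, path] at h1 h2 ⊢
      rw [← h2, h1]

theorem mem_wordCylinder_iff {w : List (α × Bool)} {ξ : Boundary α} :
    ξ ∈ wordCylinder w ↔ ξ.initial w.length = w := Iff.rfl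

theorem wordCylinder_nil : wordCylinder ([] : List (α × Bool)) = Set.univ := by
  ext ξ; simp [wordCylinder, Boundary.initial]

theorem measurableSet_wordCylinder (w : List (α × Bool)) : MeasurableSet (wordCylinder w) :=
  (isOpen_wordCylinder w).measurableSet

theorem measurable_pathRay [Finite α] : Measurable (pathRay (α := α)) := by
  classical
  have h : (borel (Boundary α)) = MeasurableSpace.generateFrom (Set.range wordCylinder) :=
    borel_eq_generateFrom_of_subbasis rfl
  change @Measurable _ _ _ (borel (Boundary α)) pathRay
  rw [h]
  refine measurable_generateFrom ?_
  rintro _ ⟨w, rfl⟩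
  rcases (wordCylinder w).eq_empty_or_nonempty with h | ⟨ζ, hζ⟩
  · rw [h]; simp
  · rcases Nat.eq_zero_or_eq_succ_pred w.length with h0 | h0
    · rw [List.length_eq_zero_iff.1 h0, wordCylinder_nil]; simp
    · rw [← mem_wordCylinder_iff.1 hζ, h0, pathRay_preimage]
      refine MeasurableSet.prod (MeasurableSet.of_discrete) (MeasurableSet.pi ?_ ?_)
      · exact Finset.countable_toSet _
      · exact fun _ _ => MeasurableSet.of_discrete

theorem card_nextLetter [Fintype α] (a : α × Bool) :
    Nat.card (NextLetter a) = 2 * Fintype.card α - 1 := by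
  classical
  have h0 : ∀ b : α × Bool, (a.1 = b.1 → a.2 = b.2) ↔ b ≠ (a.1, !a.2) := by
    rintro ⟨b, c⟩
    obtain ⟨a, d⟩ := a
    cases c <;> cases d <;> simp [eq_comm]
  have h1 : NextLetter a ≃ {b : α × Bool // b ≠ (a.1, !a.2)} :=
    { toFun := fun b => ⟨b.letter, (h0 _).1 b.reduced⟩
      invFun := fun b => ⟨b.1, (h0 _).2 b.2⟩
      left_inv := fun _ => rfl
      right_inv := fun _ => rfl }
  rw [Nat.card_congr h1, Nat.card_eq_fintype_card, Fintype.card_subtype_compl]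
  simp [mul_comm]

theorem uniformOn_singleton_eq {Ω : Type*} [MeasurableSpace Ω] [DiscreteMeasurableSpace Ω]
    [Finite Ω] (c : Ω) :
    ProbabilityTheory.uniformOn (Set.univ : Set Ω) {c} = (Nat.card Ω : ℝ≥0∞)⁻¹ := by
  have := Fintype.ofFinite Ω
  rw [ProbabilityTheory.uniformOn_univ, Measure.count_singleton, Nat.card_eq_fintype_card,
    one_div]

theorem uniformMeasure_initial [Fintype α] (ζ : Boundary α) (n : ℕ) :
    uniformMeasure α (wordCylinder (ζ.initial (n + 1))) =
      ((2 * Fintype.card α * (2 * Fintype.card α - 1) ^ n : ℕ) : ℝ≥0∞)⁻¹ := by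
  classical
  have hprob : Nonempty (FirstLetter α) := ⟨⟨ζ.letter 0⟩⟩
  rw [uniformMeasure, Measure.map_apply measurable_pathRay (measurableSet_wordCylinder _),
    pathRay_preimage, Measure.prod_prod, Measure.infinitePi_pi
      (fun i : ℕ × (α × Bool) => ProbabilityTheory.uniformOn (Set.univ : Set (NextLetter i.2)))
      (fun _ _ => MeasurableSet.of_discrete), Finset.prod_image (by
        intro i _ j _ h; exact congrArg Prod.fst h)]
  have h1 : ∀ i ∈ Finset.range n, ProbabilityTheory.uniformOn (Set.univ : Set (NextLetter (ζ.letter i)))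
      {c | c.letter = ζ.letter (i + 1)} = ((2 * Fintype.card α - 1 : ℕ) : ℝ≥0∞)⁻¹ := by
    intro i _
    have : {c : NextLetter (ζ.letter i) | c.letter = ζ.letter (i + 1)} =
        {⟨ζ.letter (i + 1), ζ.reduced i⟩} := by
      ext c; simp [NextLetter.ext_iff]
    rw [this, uniformOn_singleton_eq, card_nextLetter]
  rw [Finset.prod_congr rfl h1, uniformOn_singleton_eq, Finset.prod_const, Finset.card_range,
    Nat.cast_mul, ENNReal.mul_inv (.inr (ENNReal.natCast_ne_top _)) (.inl (ENNReal.natCast_ne_top _)), Nat.cast_pow, ENNReal.inv_pow]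
  congr 2
  have e : FirstLetter α ≃ α × Bool := ⟨fun a => a.letter, fun a => ⟨a⟩, fun _ => rfl, fun _ => rfl⟩
  rw [Nat.card_congr e]
  simp [mul_comm]

theorem exists_mem_wordCylinder {w : List (α × Bool)} (hw : FreeGroup.IsReduced w)
    (h0 : w ≠ []) : ∃ ξ : Boundary α, ξ ∈ wordCylinder w := by
  have hl := List.length_pos_iff.2 h0
  have hr : ∀ n, (w[min n (w.length - 1)]'(by omega)).1 = (w[min (n + 1) (w.length - 1)]'(by omega)).1
      → (w[min n (w.length - 1)]'(by omega)).2 = (w[min (n + 1) (w.length - 1)]'(by omega)).2 := by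
    intro n
    by_cases hn : n + 1 < w.length
    · rw [FreeGroup.IsReduced, List.isChain_iff_getElem] at hw
      have := hw n hn
      simpa [Nat.min_eq_left (show n ≤ w.length - 1 by omega),
        Nat.min_eq_left (show n + 1 ≤ w.length - 1 by omega)] using this
    · have h1 : min n (w.length - 1) = w.length - 1 := by omega
      have h2 : min (n + 1) (w.length - 1) = w.length - 1 := by omega
      simp [h1, h2]
  let ξ : Boundary α := ⟨fun n => w[min n (w.length - 1)]'(by omega), hr⟩
  refine ⟨ξ, mem_wordCylinder_iff.2 (List.ext_getElem (by simp [Boundary.initial]) ?_)⟩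
  intro i h1 h2
  simp [Boundary.initial, ξ, Nat.min_eq_left (show i ≤ w.length - 1 by omega)]

/-- The uniform measure of a cylinder. -/
theorem uniformMeasure_wordCylinder [Fintype α] {w : List (α × Bool)}
    (hw : FreeGroup.IsReduced w) (h0 : w ≠ []) :
    uniformMeasure α (wordCylinder w) =
      ((2 * Fintype.card α * (2 * Fintype.card α - 1) ^ (w.length - 1) : ℕ) : ℝ≥0∞)⁻¹ := by
  obtain ⟨ξ, hξ⟩ := exists_mem_wordCylinder hw h0
  have hl := List.length_pos_iff.2 h0
  have := uniformMeasure_initial ξ (w.length - 1)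
  rwa [Nat.sub_add_cancel hl, mem_wordCylinder_iff.1 hξ] at this

theorem uniformMeasure_cylinder [Fintype α] [DecidableEq α] {v : FreeGroup α} (hv : v ≠ 1) :
    uniformMeasure α (cylinder v) =
      ((2 * Fintype.card α * (2 * Fintype.card α - 1) ^ (v.norm - 1) : ℕ) : ℝ≥0∞)⁻¹ :=
  uniformMeasure_wordCylinder FreeGroup.isReduced_toWord
    (by rwa [Ne, FreeGroup.toWord_eq_nil_iff])

instance [Finite α] : IsFiniteMeasure (uniformMeasure α) := by
  rw [uniformMeasure]
  infer_instance

theorem uniformMeasure_univ [Finite α] [Nonempty α] : uniformMeasure α Set.univ = 1 := by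
  have : Nonempty (FirstLetter α) := ⟨⟨Classical.arbitrary _⟩⟩
  rw [uniformMeasure, Measure.map_apply measurable_pathRay MeasurableSet.univ]
  simp

end UniformMeasure
section UniformCurrent

variable {α : Type*}

/-- The length of the maximal common initial segment of the two points. -/
noncomputable def commonLength (p : DoubleBoundary α) : ℕ :=
  sInf {n | p.1.1.letter n ≠ p.1.2.letter n}

/-- The uniform current: the measure on pairs of distinct boundary points whose density with
respect to the square of the uniform measure is `2 k (2 k - 1) ^ (2 L - 1)`, where `k` is the rank
and `L` is the length of the common initial segment. It is the geodesic current that gives to the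
cylinder of a segment `[x, y]` the uniform measure of the cylinder of `x⁻¹ * y`: see
`uniformCurrent_segmentCylinder`. -/
noncomputable def uniformCurrent (α : Type*) [Fintype α] : Measure (DoubleBoundary α) :=
  (((uniformMeasure α).prod (uniformMeasure α)).comap Subtype.val).withDensity fun p =>
    ((2 * Fintype.card α : ℕ) : ℝ≥0∞) * ((2 * Fintype.card α - 1 : ℕ) : ℝ≥0∞) ^
      (2 * commonLength p) / ((2 * Fintype.card α - 1 : ℕ) : ℝ≥0∞)

theorem mem_wordCylinder_iff_get {w : List (α × Bool)} {ξ : Boundary α} :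
    ξ ∈ wordCylinder w ↔ ∀ i (h : i < w.length), ξ.letter i = w[i] := by
  rw [mem_wordCylinder_iff]
  constructor
  · intro h i hi
    have : (ξ.initial w.length)[i]'(by rw [ξ.length_initial]; exact hi) = w[i] := by simp only [h]
    rw [← this]
    simp [Boundary.initial]
  · intro h
    refine List.ext_getElem (by simp [Boundary.initial]) fun i h1 h2 => ?_
    rw [← h i h2]
    simp [Boundary.initial]

instance : T2Space (Boundary α) := by
  refine ⟨fun ξ ζ h => ?_⟩
  obtain ⟨n, hn⟩ : ∃ n, ξ.initial n ≠ ζ.initial n := by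
    by_contra! h'
    exact h (Boundary.ext_initial h')
  refine ⟨_, _, isOpen_wordCylinder (ξ.initial n), isOpen_wordCylinder (ζ.initial n),
    by simp [wordCylinder, Boundary.length_initial], by simp [wordCylinder, Boundary.length_initial],
    Set.disjoint_left.2 fun x h1 h2 => hn ?_⟩
  simp only [mem_wordCylinder_iff, Boundary.length_initial] at h1 h2
  rw [← h1, h2]

/-- The pairs of distinct points with the first in `U` and the second in `V`. -/
def rect (U V : Set (Boundary α)) : Set (DoubleBoundary α) := {p | p.1.1 ∈ U ∧ p.1.2 ∈ V}

theorem measurableSet_rect {U V : Set (Boundary α)} (hU : MeasurableSet U)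
    (hV : MeasurableSet V) : MeasurableSet (rect U V) :=
  (hU.prod hV).preimage measurable_subtype_coe

theorem commonLength_eq {c u v : List (α × Bool)} {a b : α × Bool} (hab : a ≠ b)
    {p : DoubleBoundary α} (h1 : p.1.1 ∈ wordCylinder (c ++ a :: u))
    (h2 : p.1.2 ∈ wordCylinder (c ++ b :: v)) : commonLength p = c.length := by
  rw [mem_wordCylinder_iff_get] at h1 h2
  refine IsLeast.csInf_eq ⟨?_, fun n hn => ?_⟩
  · have e1 := h1 c.length (by simp)
    have e2 := h2 c.length (by simp)
    simp only [List.getElem_append_right le_rfl, Nat.sub_self, List.getElem_cons_zero] at e1 e2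
    change p.1.1.letter c.length ≠ p.1.2.letter c.length
    rwa [e1, e2]
  · by_contra! hlt
    have e1 := h1 n (by simp; omega)
    have e2 := h2 n (by simp; omega)
    rw [List.getElem_append_left hlt] at e1 e2
    exact hn (e1.trans e2.symm)

/-- The uniform measure of the cylinder of a word of length `n ≥ 1`. -/
noncomputable def weight (α : Type*) [Fintype α] (n : ℕ) : ℝ≥0∞ :=
  ((2 * Fintype.card α * (2 * Fintype.card α - 1) ^ (n - 1) : ℕ) : ℝ≥0∞)⁻¹

theorem card_facts [Fintype α] (a : α × Bool) : 1 ≤ 2 * Fintype.card α - 1 := by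
  have : 0 < Fintype.card α := Fintype.card_pos_iff.2 ⟨a.1⟩
  omega

theorem weight_aux {K q : ℕ} (hK : 1 ≤ K) (hq : 1 ≤ q) (c u v : ℕ) :
    (K : ℝ≥0∞) * (q : ℝ≥0∞) ^ (2 * c) / q *
      (((K * q ^ (c + u) : ℕ) : ℝ≥0∞)⁻¹ * ((K * q ^ (c + v) : ℕ) : ℝ≥0∞)⁻¹) =
      ((K * q ^ (u + v + 1) : ℕ) : ℝ≥0∞)⁻¹ := by
  have hK0 : (K : ℝ≥0) ≠ 0 := by exact_mod_cast (by omega : K ≠ 0)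
  have hq0 : (q : ℝ≥0) ≠ 0 := by exact_mod_cast (by omega : q ≠ 0)
  have key : (K : ℝ≥0) * (q : ℝ≥0) ^ (2 * c) / q *
      (((K * q ^ (c + u) : ℕ) : ℝ≥0)⁻¹ * ((K * q ^ (c + v) : ℕ) : ℝ≥0)⁻¹) =
      ((K * q ^ (u + v + 1) : ℕ) : ℝ≥0)⁻¹ := by
    push_cast
    field_simp
    ring
  have h : ∀ m n : ℕ, ((K * q ^ (m + n) : ℕ) : ℝ≥0) ≠ 0 := by
    intro m n
    push_cast
    positivity
  have := congrArg (fun x : ℝ≥0 => (x : ℝ≥0∞)) key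
  simp only [ENNReal.coe_mul, ENNReal.coe_inv (h _ _), ENNReal.coe_div hq0,
    ENNReal.coe_pow, ENNReal.coe_natCast] at this
  exact this

theorem mul_weight [Fintype α] (a : α × Bool) {n : ℕ} (hn : 1 ≤ n) :
    ((2 * Fintype.card α - 1 : ℕ) : ℝ≥0∞) * weight α (n + 1) = weight α n := by
  have hq := card_facts a
  obtain ⟨m, rfl⟩ : ∃ m, n = m + 1 := ⟨n - 1, by omega⟩
  set q := 2 * Fintype.card α - 1 with hqd
  have e : (2 * Fintype.card α * q ^ (m + 1) : ℕ) = q * (2 * Fintype.card α * q ^ m) := by ring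
  simp only [weight, Nat.add_sub_cancel]
  rw [e, Nat.cast_mul, ENNReal.mul_inv (.inr (ENNReal.natCast_ne_top _))
    (.inl (ENNReal.natCast_ne_top _)), ← mul_assoc,
    ENNReal.mul_inv_cancel (by exact_mod_cast (by omega : q ≠ 0)) (ENNReal.natCast_ne_top _),
    one_mul]

theorem uniformCurrent_rect [Fintype α] {c u v : List (α × Bool)} {a b : α × Bool} (hab : a ≠ b)
    (hu : FreeGroup.IsReduced (c ++ a :: u)) (hv : FreeGroup.IsReduced (c ++ b :: v)) :
    uniformCurrent α (rect (wordCylinder (c ++ a :: u)) (wordCylinder (c ++ b :: v))) =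
      weight α (u.length + v.length + 2) := by
  have hm := measurableSet_rect (measurableSet_wordCylinder (c ++ a :: u))
    (measurableSet_wordCylinder (c ++ b :: v))
  have hd : MeasurableSet {p : Boundary α × Boundary α | p.1 ≠ p.2} :=
    (isClosed_diagonal (X := Boundary α)).measurableSet.compl
  have hemb : MeasurableEmbedding (Subtype.val : DoubleBoundary α → Boundary α × Boundary α) :=
    MeasurableEmbedding.subtype_coe hd
  have himg : Subtype.val '' rect (wordCylinder (c ++ a :: u)) (wordCylinder (c ++ b :: v)) =
      wordCylinder (c ++ a :: u) ×ˢ wordCylinder (c ++ b :: v) := by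
    ext ⟨ξ, ζ⟩
    constructor
    · rintro ⟨p, hp, h⟩
      rw [← h]
      exact hp
    · rintro h
      refine ⟨⟨(ξ, ζ), fun e => ?_⟩, h, rfl⟩
      have h1 := (mem_wordCylinder_iff_get.1 h.1) c.length (by simp)
      have h2 := (mem_wordCylinder_iff_get.1 h.2) c.length (by simp)
      simp only [List.getElem_append_right le_rfl, Nat.sub_self, List.getElem_cons_zero] at h1 h2
      simp only at e
      rw [e, h2] at h1
      exact hab h1.symm
  rw [uniformCurrent, withDensity_apply _ hm,
    setLIntegral_congr_fun hm (g := fun _ => ((2 * Fintype.card α : ℕ) : ℝ≥0∞) *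
      ((2 * Fintype.card α - 1 : ℕ) : ℝ≥0∞) ^ (2 * c.length) /
      ((2 * Fintype.card α - 1 : ℕ) : ℝ≥0∞))
      (fun p hp => by simp only [commonLength_eq hab hp.1 hp.2]),
    setLIntegral_const, hemb.comap_apply, himg,
    Measure.prod_prod, uniformMeasure_wordCylinder hu (by simp),
    uniformMeasure_wordCylinder hv (by simp)]
  have := card_facts a
  simp only [List.length_append, List.length_cons, weight]
  exact weight_aux (by omega) this c.length u.length v.length

theorem wordCylinder_append_subset (u v : List (α × Bool)) :
    wordCylinder (u ++ v) ⊆ wordCylinder u := by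
  intro ξ h
  rw [mem_wordCylinder_iff_get] at h ⊢
  intro i hi
  rw [h i (by simp; omega), List.getElem_append_left hi]

theorem mem_wordCylinder_append_singleton {u : List (α × Bool)} {a : α × Bool} {ξ : Boundary α} :
    ξ ∈ wordCylinder (u ++ [a]) ↔ ξ ∈ wordCylinder u ∧ ξ.letter u.length = a := by
  rw [mem_wordCylinder_iff, mem_wordCylinder_iff, List.length_append, List.length_singleton,
    Boundary.initial_succ]
  constructor
  · intro h
    have := List.append_inj h (by simp [Boundary.length_initial])
    exact ⟨this.1, by simpa using this.2⟩
  · rintro ⟨h1, h2⟩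
    rw [h1, h2]

theorem measure_biUnion_letters (m : Measure (Boundary α)) (u : List (α × Bool))
    (T : Finset (α × Bool)) (C : ℝ≥0∞) (h : ∀ a ∈ T, m (wordCylinder (u ++ [a])) = C) :
    m (⋃ a ∈ T, wordCylinder (u ++ [a])) = T.card * C := by
  rw [measure_biUnion_finset, Finset.sum_congr rfl h, Finset.sum_const, nsmul_eq_mul]
  · intro a _ b _ hab
    refine Set.disjoint_left.2 fun ξ h1 h2 => hab ?_
    rw [mem_wordCylinder_append_singleton] at h1 h2
    exact h1.2.symm.trans h2.2
  · exact fun _ _ => measurableSet_wordCylinder _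

theorem measure_compl_wordCylinder [Fintype α] (m : Measure (Boundary α)) {y : List (α × Bool)}
    (hy : FreeGroup.IsReduced y)
    (hm : ∀ n (hn : n < y.length) (a : α × Bool), a ≠ y[n] →
      FreeGroup.IsReduced (y.take n ++ [a]) →
      m (wordCylinder (y.take n ++ [a])) = weight α (y.length - n + 1)) :
    ∀ n, n < y.length → m (wordCylinder (y.take (n + 1)))ᶜ = weight α (y.length - n) := by
  classical
  intro n
  induction n with
  | zero =>
    intro hn
    have e : (wordCylinder (y.take 1))ᶜ =
        ⋃ a ∈ Finset.univ.erase y[0], wordCylinder (([] : List (α × Bool)) ++ [a]) := by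
      rw [show y.take 1 = [] ++ [y[0]] by simp [List.take_one, List.head?_eq_getElem?, hn]]
      ext ξ
      simp only [Set.mem_compl_iff, mem_wordCylinder_append_singleton, wordCylinder_nil,
        Set.mem_univ, true_and, Set.mem_iUnion, Finset.mem_erase, Finset.mem_univ, and_true,
        List.length_nil, exists_prop]
      constructor
      · intro h
        exact ⟨_, h, rfl⟩
      · rintro ⟨a, h, rfl⟩
        exact h
    rw [zero_add, e, measure_biUnion_letters _ _ _ (weight α (y.length + 1))]
    · rw [Finset.card_erase_of_mem (Finset.mem_univ _), Finset.card_univ, Fintype.card_prod,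
        Fintype.card_bool, mul_comm (Fintype.card α) 2, mul_weight y[0] (by omega), Nat.sub_zero]
    · intro a ha
      have := hm 0 hn a (Finset.ne_of_mem_erase ha) (by simp)
      simpa using this
  | succ n ih =>
    intro hn
    set u := y.take (n + 1) with hu
    have hul : u.length = n + 1 := by rw [hu, List.length_take]; omega
    let T : Finset (α × Bool) := (Finset.univ.filter fun a => y[n].1 = a.1 → y[n].2 = a.2).erase y[n + 1]
    have huy : y.take (n + 1 + 1) = u ++ [y[n + 1]] := by rw [hu, List.take_append_getElem]
    have hred := List.isChain_iff_getElem.1 hy n hn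
    have hlast : ∀ ξ ∈ wordCylinder u, ξ.letter n = y[n] := by
      intro ξ hξ
      rw [mem_wordCylinder_iff_get.1 hξ n (by omega)]
      simp [hu]
    have e : (wordCylinder (y.take (n + 1 + 1)))ᶜ =
        (wordCylinder u)ᶜ ∪ ⋃ a ∈ T, wordCylinder (u ++ [a]) := by
      rw [huy]
      ext ξ
      simp only [Set.mem_compl_iff, mem_wordCylinder_append_singleton, Set.mem_union,
        Set.mem_iUnion, exists_prop, T, Finset.mem_erase, Finset.mem_filter, Finset.mem_univ,
        true_and, hul]
      constructor
      · intro h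
        by_cases h1 : ξ ∈ wordCylinder u
        · right
          refine ⟨ξ.letter (n + 1), ⟨fun h2 => h ⟨h1, h2⟩, ?_⟩, h1, rfl⟩
          rw [← hlast ξ h1]
          exact ξ.reduced n
        · exact Or.inl h1
      · rintro (h | ⟨a, ⟨h1, -⟩, h2, rfl⟩)
        · exact fun h' => h h'.1
        · exact fun h' => h1 h'.2
    have hT : T.card = 2 * Fintype.card α - 1 - 1 := by
      rw [Finset.card_erase_of_mem (by simpa using hred), ← card_nextLetter y[n]]
      have e1 : NextLetter y[n] ≃ {a : α × Bool // y[n].1 = a.1 → y[n].2 = a.2} :=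
        { toFun := fun b => ⟨b.letter, b.reduced⟩
          invFun := fun b => ⟨b.1, b.2⟩
          left_inv := fun _ => rfl
          right_inv := fun _ => rfl }
      rw [Nat.card_congr e1, Nat.card_eq_fintype_card, Fintype.card_subtype]
    have hdisj : Disjoint (wordCylinder u)ᶜ (⋃ a ∈ T, wordCylinder (u ++ [a])) := by
      refine Set.disjoint_left.2 fun ξ h1 h2 => h1 ?_
      simp only [Set.mem_iUnion] at h2
      obtain ⟨a, _, h⟩ := h2
      exact wordCylinder_append_subset _ _ h
    have hq := card_facts y[n]
    rw [e, measure_union hdisj (Finset.measurableSet_biUnion _ fun _ _ =>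
      measurableSet_wordCylinder _), ih (by omega),
      measure_biUnion_letters _ _ _ (weight α (y.length - n)), hT]
    · rw [← one_add_mul, show (1 : ℝ≥0∞) + ((2 * Fintype.card α - 1 - 1 : ℕ) : ℝ≥0∞) =
        ((2 * Fintype.card α - 1 : ℕ) : ℝ≥0∞) by
          rw [← Nat.cast_one, ← Nat.cast_add]; congr 1; omega]
      have := mul_weight y[n] (n := y.length - (n + 1)) (by omega)
      rwa [show y.length - (n + 1) + 1 = y.length - n by omega] at this
    · intro a ha
      simp only [T, Finset.mem_erase, Finset.mem_filter, Finset.mem_univ, true_and] at ha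
      have := hm (n + 1) hn a ha.1 (by
        rw [FreeGroup.IsReduced, List.isChain_append]
        refine ⟨hy.take _, by simp, ?_⟩
        intro b hb d hd
        rw [List.getLast?_take] at hb
        simp at hb hd
        rcases hb with hb | hb
        · rw [List.getElem?_eq_getElem (by omega), Option.some.injEq] at hb
          rw [← hd, ← hb]
          exact ha.2
        · omega)
      rw [this]
      congr 1
      omega

theorem uniformCurrent_rect_compl_left [Fintype α] {x v : List (α × Bool)} {b : α × Bool}
    (h : FreeGroup.IsReduced (x ++ b :: v)) :
    uniformCurrent α (rect (wordCylinder (x ++ [b]))ᶜ (wordCylinder (x ++ b :: v))) =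
      weight α (v.length + 1) := by
  set y := x ++ b :: v with hy
  let m : Measure (Boundary α) :=
    ((uniformCurrent α).restrict (rect Set.univ (wordCylinder y))).map fun p => p.1.1
  have hms : Measurable fun p : DoubleBoundary α => p.1.1 := by fun_prop
  have hm : ∀ U, MeasurableSet U → m U = uniformCurrent α (rect U (wordCylinder y)) := by
    intro U hU
    rw [Measure.map_apply hms hU, Measure.restrict_apply (hms hU)]
    congr 1
    ext p
    simp [rect]
  have := measure_compl_wordCylinder m h (fun n hn a ha hr => by
    rw [hm _ (measurableSet_wordCylinder _)]
    have e : y = y.take n ++ y[n] :: y.drop (n + 1) := by simp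
    have h1 := uniformCurrent_rect (u := []) (v := y.drop (n + 1)) (c := y.take n) ha hr
      (e ▸ h)
    rw [← e] at h1
    rw [h1, List.length_drop, List.length_nil]
    congr 1
    omega) x.length (by simp [hy])
  rw [hm _ (measurableSet_wordCylinder _).compl] at this
  rw [show y.take (x.length + 1) = x ++ [b] by simp [hy, List.take_append]] at this
  rw [this]
  congr 1
  simp [hy]

theorem uniformCurrent_rect_compl_right [Fintype α] {x v : List (α × Bool)} {b : α × Bool}
    (h : FreeGroup.IsReduced (x ++ b :: v)) :
    uniformCurrent α (rect (wordCylinder (x ++ b :: v)) (wordCylinder (x ++ [b]))ᶜ) =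
      weight α (v.length + 1) := by
  set y := x ++ b :: v with hy
  let m : Measure (Boundary α) :=
    ((uniformCurrent α).restrict (rect (wordCylinder y) Set.univ)).map fun p => p.1.2
  have hms : Measurable fun p : DoubleBoundary α => p.1.2 := by fun_prop
  have hm : ∀ U, MeasurableSet U → m U = uniformCurrent α (rect (wordCylinder y) U) := by
    intro U hU
    rw [Measure.map_apply hms hU, Measure.restrict_apply (hms hU)]
    congr 1
    ext p
    simp [rect, and_comm]
  have := measure_compl_wordCylinder m h (fun n hn a ha hr => by
    rw [hm _ (measurableSet_wordCylinder _)]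
    have e : y = y.take n ++ y[n] :: y.drop (n + 1) := by simp
    have h1 := uniformCurrent_rect (v := []) (u := y.drop (n + 1)) (c := y.take n) ha.symm
      (e ▸ h) hr
    rw [← e] at h1
    rw [h1, List.length_drop, List.length_nil]
    congr 1
    omega) x.length (by simp [hy])
  rw [hm _ (measurableSet_wordCylinder _).compl] at this
  rw [show y.take (x.length + 1) = x ++ [b] by simp [hy, List.take_append]] at this
  rw [this]
  congr 1
  simp [hy]

end UniformCurrent
section Geodesics

variable {α : Type*} [DecidableEq α]

theorem isReduced_of_norm_mul {g h : FreeGroup α} (e : (g * h).norm = g.norm + h.norm) :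
    FreeGroup.IsReduced (g.toWord ++ h.toWord) := by
  have h1 := FreeGroup.toWord_mul_sublist g h
  have h2 := h1.eq_of_length (by rw [List.length_append]; exact e)
  rw [← h2]
  exact FreeGroup.isReduced_toWord

/-- If the geodesic from `x` to `g` passes through `y`, and the reduced words of `y` and of
`x⁻¹ * y` have the same last letter, then the word of `g` starts with the word of `y`. -/
theorem prefix_of_norm_add {x y g : FreeGroup α} {c t s : List (α × Bool)} (hs : s ≠ [])
    (h1 : y.toWord = c ++ s) (h2 : (x⁻¹ * y).toWord = t ++ s)
    (h3 : (x⁻¹ * g).norm = (x⁻¹ * y).norm + (y⁻¹ * g).norm) : y.toWord <+: g.toWord := by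
  have e : x⁻¹ * g = (x⁻¹ * y) * (y⁻¹ * g) := by group
  rw [e] at h3
  have h4 := isReduced_of_norm_mul h3
  rw [h2, List.append_assoc] at h4
  have h5 : FreeGroup.IsReduced (s ++ (y⁻¹ * g).toWord) := (List.isChain_append.1 h4).2.1
  have h6 : FreeGroup.IsReduced (c ++ s) := h1 ▸ FreeGroup.isReduced_toWord
  have h7 := FreeGroup.IsReduced.append_overlap h6 h5 hs
  rw [← h1] at h7
  have h8 : g = y * (y⁻¹ * g) := by group
  have h9 : g.toWord = y.toWord ++ (y⁻¹ * g).toWord := by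
    conv_lhs => rw [h8]
    rw [FreeGroup.toWord_mul, h7.reduce_eq]
  rw [h9]
  exact List.prefix_append _ _

/-- The reduced word of `x⁻¹ * y` when `x` and `y` have the maximal common initial segment `c`. -/
theorem toWord_inv_mul {x y : FreeGroup α} {c u v : List (α × Bool)}
    (hx : x.toWord = c ++ u) (hy : y.toWord = c ++ v)
    (h : ∀ a ∈ u.head?, ∀ b ∈ v.head?, a ≠ b) :
    (x⁻¹ * y).toWord = FreeGroup.invRev u ++ v := by
  have hu : FreeGroup.IsReduced u := by
    have : FreeGroup.IsReduced (c ++ u) := hx ▸ FreeGroup.isReduced_toWord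
    exact (List.isChain_append.1 this).2.1
  have hv : FreeGroup.IsReduced v := by
    have : FreeGroup.IsReduced (c ++ v) := hy ▸ FreeGroup.isReduced_toWord
    exact (List.isChain_append.1 this).2.1
  have hu' : FreeGroup.IsReduced (FreeGroup.invRev u) := by
    rw [FreeGroup.isReduced_iff_reduce_eq, FreeGroup.reduce_invRev, hu.reduce_eq]
  have e : x⁻¹ * y = FreeGroup.mk (FreeGroup.invRev u ++ v) := by
    rw [← FreeGroup.mk_toWord (x := x), ← FreeGroup.mk_toWord (x := y), hx, hy,
      ← FreeGroup.mul_mk, ← FreeGroup.mul_mk, ← FreeGroup.mul_mk, ← FreeGroup.inv_mk]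
    group
  rw [e, toWord_mk_of_isReduced]
  rw [FreeGroup.IsReduced, List.isChain_append]
  refine ⟨hu', hv, ?_⟩
  intro a ha b hb
  cases u with
  | nil => simp at ha
  | cons d u =>
    have : a = (d.1, !d.2) := by
      simpa [FreeGroup.invRev, eq_comm] using ha
    have hdb := h d (by simp) b hb
    rw [this]
    obtain ⟨d1, d2⟩ := d
    obtain ⟨b1, b2⟩ := b
    intro h1
    simp only at h1 ⊢
    subst h1
    cases d2 <;> cases b2 <;> simp_all

theorem IsGeodesicLine.norm_add {γ : ℤ → FreeGroup α} {ξ ζ : Boundary α}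
    (h : IsGeodesicLine γ ξ ζ) {i j k : ℤ} (hij : i ≤ j) (hjk : j ≤ k) :
    ((γ i)⁻¹ * γ k).norm = ((γ i)⁻¹ * γ j).norm + ((γ j)⁻¹ * γ k).norm := by
  have h1 := h.isometry i k
  have h2 := h.isometry i j
  have h3 := h.isometry j k
  rw [abs_of_nonpos (by omega)] at h1 h2 h3
  omega

theorem IsGeodesicLine.reverse {γ : ℤ → FreeGroup α} {ξ ζ : Boundary α}
    (h : IsGeodesicLine γ ξ ζ) : IsGeodesicLine (fun n => γ (-n)) ζ ξ where
  isometry i j := by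
    rw [h.isometry, ← abs_neg]
    congr 1
    ring
  left := by simpa using h.right
  right := h.left

theorem ConvergesTo.mem_wordCylinder {g : ℕ → FreeGroup α} {ξ : Boundary α}
    (h : ConvergesTo g ξ) {w : List (α × Bool)} (hw : ∀ᶠ n in atTop, w <+: (g n).toWord) :
    ξ ∈ wordCylinder w := by
  obtain ⟨n, h1, h2⟩ := ((h w.length).and hw).exists
  rw [mem_wordCylinder_iff]
  exact (List.prefix_of_prefix_length_le h1 h2 (by simp [Boundary.length_initial])).eq_of_length
    (by simp [Boundary.length_initial])

theorem ConvergesTo.eventually_prefix {g : ℕ → FreeGroup α} {ξ : Boundary α}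
    (h : ConvergesTo g ξ) {w : List (α × Bool)} (hw : ξ ∈ wordCylinder w) :
    ∀ᶠ n in atTop, w <+: (g n).toWord := by
  have := h w.length
  rwa [mem_wordCylinder_iff.1 hw] at this

/-- A path in the Cayley graph without backtracking is a geodesic. -/
theorem norm_of_local {γ : ℤ → FreeGroup α} {s : ℤ → α × Bool}
    (h1 : ∀ i, γ (i + 1) = γ i * FreeGroup.mk [s i])
    (h2 : ∀ i, (s i).1 = (s (i + 1)).1 → (s i).2 = (s (i + 1)).2) (i j : ℤ) :
    (((γ i)⁻¹ * γ j).norm : ℤ) = |i - j| := by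
  have key : ∀ (i : ℤ) (n : ℕ), ((γ i)⁻¹ * γ (i + n)).norm = n := by
    intro i n
    have e : (γ i)⁻¹ * γ (i + n) = FreeGroup.mk ((List.range n).map fun k : ℕ => s (i + k)) := by
      induction n with
      | zero => simp [← FreeGroup.one_eq_mk]
      | succ n ih =>
        rw [List.range_succ, List.map_append, ← FreeGroup.mul_mk, ← ih, mul_assoc]
        congr 1
        rw [Nat.cast_add, Nat.cast_one, ← add_assoc, h1]
        rfl
    rw [e, FreeGroup.norm, toWord_mk_of_isReduced]
    · simp
    · rw [FreeGroup.IsReduced, List.isChain_iff_getElem]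
      intro k hk
      have := h2 (i + k)
      simpa [add_assoc] using this
  rcases le_total i j with h | h
  · obtain ⟨n, rfl⟩ : ∃ n : ℕ, j = i + n := ⟨(j - i).toNat, by omega⟩
    rw [key, abs_of_nonpos (by omega)]
    omega
  · obtain ⟨n, rfl⟩ : ∃ n : ℕ, i = j + n := ⟨(i - j).toNat, by omega⟩
    have e : (γ (j + n))⁻¹ * γ j = ((γ j)⁻¹ * γ (j + n))⁻¹ := by group
    rw [e, FreeGroup.norm_inv_eq, key, abs_of_nonneg (by omega)]
    omega

/-- The geodesic between two distinct boundary points, and its vertices. -/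
theorem exists_geodesicLine (p : DoubleBoundary α) :
    ∃ γ : ℤ → FreeGroup α, IsGeodesicLine γ p.1.1 p.1.2 ∧
      (∀ n : ℕ, γ n = FreeGroup.mk (p.1.2.initial (commonLength p + n))) ∧
      (∀ n : ℕ, γ (-n) = FreeGroup.mk (p.1.1.initial (commonLength p + n))) := by
  obtain ⟨⟨ξ, ζ⟩, hne⟩ := p
  set L := commonLength ⟨(ξ, ζ), hne⟩ with hL
  have hset : {n | ξ.letter n ≠ ζ.letter n}.Nonempty := by
    by_contra h
    rw [Set.not_nonempty_iff_eq_empty] at h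
    refine hne (Boundary.ext (funext fun n => ?_))
    by_contra h'
    have : n ∈ {n | ξ.letter n ≠ ζ.letter n} := h'
    rw [h] at this
    exact this
  have hLne : ξ.letter L ≠ ζ.letter L := Nat.sInf_mem hset
  have hLeq : ξ.initial L = ζ.initial L := by
    refine List.map_congr_left fun n hn => ?_
    by_contra h
    exact absurd (Nat.sInf_le (s := {n | ξ.letter n ≠ ζ.letter n}) h)
      (by rw [List.mem_range] at hn; exact not_le.2 hn)
  let γ : ℤ → FreeGroup α := fun n =>
    if 0 ≤ n then FreeGroup.mk (ζ.initial (L + n.toNat))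
    else FreeGroup.mk (ξ.initial (L + (-n).toNat))
  have hpos : ∀ n : ℕ, γ n = FreeGroup.mk (ζ.initial (L + n)) := fun n => by simp [γ]
  have hneg : ∀ n : ℕ, γ (-n) = FreeGroup.mk (ξ.initial (L + n)) := fun n => by
    rcases Nat.eq_zero_or_pos n with rfl | hn
    · simp [γ, hLeq]
    · simp only [γ]
      rw [if_neg (by omega)]
      simp
  let s : ℤ → α × Bool := fun n =>
    if 0 ≤ n then ζ.letter (L + n.toNat)
    else ((ξ.letter (L + (-n - 1).toNat)).1, !(ξ.letter (L + (-n - 1).toNat)).2)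
  have hspos : ∀ n : ℕ, s n = ζ.letter (L + n) := fun n => by simp [s]
  have hsneg : ∀ n : ℕ, s (-(n + 1 : ℕ)) = ((ξ.letter (L + n)).1, !(ξ.letter (L + n)).2) :=
    fun n => by
      simp only [s]
      rw [if_neg (by omega)]
      have : (-(-((n + 1 : ℕ) : ℤ)) - 1).toNat = n := by omega
      rw [this]
  have hconv : ∀ θ : Boundary α, ConvergesTo (fun n => FreeGroup.mk (θ.initial (L + n))) θ := by
    intro θ m
    filter_upwards [eventually_ge_atTop m] with n hn
    rw [toWord_vertex]
    exact θ.initial_prefix (by omega)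
  refine ⟨γ, ⟨norm_of_local (s := s) ?_ ?_, ?_, ?_⟩, hpos, hneg⟩
  · intro i
    rcases le_or_gt 0 i with hi | hi
    · obtain ⟨n, rfl⟩ := Int.eq_ofNat_of_zero_le hi
      have := hpos (n + 1)
      push_cast at this
      rw [this, hpos, hspos, FreeGroup.mul_mk, ← Boundary.initial_succ]
      rfl
    · obtain ⟨n, rfl⟩ : ∃ n : ℕ, i = -(n + 1 : ℕ) := ⟨(-i - 1).toNat, by omega⟩
      rw [show -((n + 1 : ℕ) : ℤ) + 1 = -(n : ℤ) by omega, hneg, hneg, hsneg, ← add_assoc,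
        Boundary.initial_succ, ← FreeGroup.mul_mk, mul_assoc]
      have : FreeGroup.mk [((ξ.letter (L + n)).1, !(ξ.letter (L + n)).2)] =
          (FreeGroup.mk [ξ.letter (L + n)])⁻¹ := by
        rw [FreeGroup.inv_mk]
        rfl
      rw [this, mul_inv_cancel, mul_one]
  · intro i
    rcases le_or_gt 0 i with hi | hi
    · obtain ⟨n, rfl⟩ := Int.eq_ofNat_of_zero_le hi
      have := hspos (n + 1)
      push_cast at this
      rw [this, hspos]
      exact ζ.reduced _
    · obtain ⟨n, rfl⟩ : ∃ n : ℕ, i = -(n + 1 : ℕ) := ⟨(-i - 1).toNat, by omega⟩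
      rcases Nat.eq_zero_or_pos n with rfl | hn
      · have h0 := hspos 0
        have h1 := hsneg 0
        rw [show -((0 + 1 : ℕ) : ℤ) + 1 = ((0 : ℕ) : ℤ) by simp, h0, h1]
        simp only [add_zero]
        intro h2
        by_contra h3
        refine hLne (Prod.ext h2 ?_)
        revert h3
        cases (ξ.letter L).2 <;> cases (ζ.letter L).2 <;> simp
      · obtain ⟨m, rfl⟩ : ∃ m, n = m + 1 := ⟨n - 1, by omega⟩
        rw [show -((m + 1 + 1 : ℕ) : ℤ) + 1 = -((m + 1 : ℕ) : ℤ) by omega, hsneg, hsneg]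
        intro h2
        have := ξ.reduced (L + m)
        simp only at h2 ⊢
        rw [← add_assoc] at h2 ⊢
        rw [this h2.symm]
  · have : (fun n : ℕ => γ (-n)) = fun n : ℕ => FreeGroup.mk (ξ.initial (L + n)) := funext hneg
    show ConvergesTo (fun n : ℕ => γ (-n)) ξ
    rw [this]
    exact hconv ξ
  · have : (fun n : ℕ => γ n) = fun n : ℕ => FreeGroup.mk (ζ.initial (L + n)) := funext hpos
    show ConvergesTo (fun n : ℕ => γ n) ζ
    rw [this]
    exact hconv ζ

theorem mem_segmentCylinder_swap {x y : FreeGroup α} {p : DoubleBoundary α} :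
    p ∈ segmentCylinder y x ↔
      (⟨(p.1.2, p.1.1), p.2.symm⟩ : DoubleBoundary α) ∈ segmentCylinder x y := by
  constructor
  · rintro ⟨γ, h, i, j, hij, h1, h2⟩
    exact ⟨_, h.reverse, -j, -i, by omega, by simpa using h2, by simpa using h1⟩
  · rintro ⟨γ, h, i, j, hij, h1, h2⟩
    exact ⟨_, h.reverse, -j, -i, by omega, by simpa using h2, by simpa using h1⟩

theorem mk_initial_eq {x : FreeGroup α} {ξ : Boundary α} (h : ξ ∈ wordCylinder x.toWord) :
    FreeGroup.mk (ξ.initial x.toWord.length) = x := by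
  rw [mem_wordCylinder_iff.1 h, FreeGroup.mk_toWord]

theorem segmentCylinder_diverging {x y : FreeGroup α} {c u v : List (α × Bool)} {a b : α × Bool}
    (hx : x.toWord = c ++ a :: u) (hy : y.toWord = c ++ b :: v) (hab : a ≠ b) :
    segmentCylinder x y = rect (wordCylinder (c ++ a :: u)) (wordCylinder (c ++ b :: v)) := by
  have hxy := toWord_inv_mul hx hy (by simpa using hab)
  have hyx := toWord_inv_mul hy hx (by simpa using hab.symm)
  ext p
  constructor
  · rintro ⟨γ, h, i, j, hij, rfl, rfl⟩
    rw [← hx, ← hy]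
    constructor
    · refine h.left.mem_wordCylinder ?_
      filter_upwards [eventually_ge_atTop (-i).toNat] with n hn
      refine prefix_of_norm_add (s := a :: u) (by simp) hx hyx ?_
      have := h.reverse.norm_add (i := -j) (j := -i) (k := n) (by omega) (by omega)
      simpa using this
    · refine h.right.mem_wordCylinder ?_
      filter_upwards [eventually_ge_atTop j.toNat] with n hn
      exact prefix_of_norm_add (s := b :: v) (by simp) hy hxy
        (h.norm_add hij (by omega))
  · rintro ⟨h1, h2⟩
    have hL := commonLength_eq hab h1 h2
    obtain ⟨γ, h, hp, hn⟩ := exists_geodesicLine p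
    rw [← hx] at h1
    rw [← hy] at h2
    refine ⟨γ, h, -((u.length + 1 : ℕ) : ℤ), ((v.length + 1 : ℕ) : ℤ), by omega, ?_, ?_⟩
    · rw [hn, hL, ← mk_initial_eq h1, hx]
      simp
    · rw [hp, hL, ← mk_initial_eq h2, hy]
      simp

theorem segmentCylinder_prefix {x y : FreeGroup α} {v : List (α × Bool)} {b : α × Bool}
    (hy : y.toWord = x.toWord ++ b :: v) :
    segmentCylinder x y = rect (wordCylinder (x.toWord ++ [b]))ᶜ
      (wordCylinder (x.toWord ++ b :: v)) := by
  have hxy := toWord_inv_mul (u := []) (List.append_nil _).symm hy (by simp)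
  ext p
  constructor
  · rintro ⟨γ, h, i, j, hij, rfl, rfl⟩
    rw [← hy]
    constructor
    · intro hξ
      obtain ⟨n, h1, h2⟩ := ((h.left.eventually_prefix hξ).and
        (eventually_ge_atTop (-i).toNat)).exists
      obtain ⟨t, ht⟩ := h1
      have h3 := h.norm_add (i := -n) (j := i) (k := j) (by omega) hij
      have e : (γ (-n))⁻¹ * γ j = ((γ (-n))⁻¹ * γ i) * ((γ i)⁻¹ * γ j) := by group
      rw [e] at h3
      have h4 := isReduced_of_norm_mul h3
      have h5 := toWord_inv_mul (x := γ (-n)) (y := γ i) (c := (γ i).toWord) (u := b :: t) (v := [])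
        (by rw [← ht]; simp) (by simp) (by simp)
      rw [h5, hxy, FreeGroup.IsReduced, List.isChain_append] at h4
      have := h4.2.2 (b.1, !b.2) (by simp [FreeGroup.invRev]) b (by simp [FreeGroup.invRev])
      simp at this
    · refine h.right.mem_wordCylinder ?_
      filter_upwards [eventually_ge_atTop j.toNat] with n hn
      exact prefix_of_norm_add (s := b :: v) (by simp) hy hxy
        (h.norm_add hij (by omega))
  · rintro ⟨h1, h2⟩
    obtain ⟨γ, h, hp, hn⟩ := exists_geodesicLine p
    have hx2 : p.1.2 ∈ wordCylinder x.toWord := wordCylinder_append_subset _ _ h2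
    have hL : commonLength p ≤ x.toWord.length := by
      by_contra! hlt
      refine h1 (mem_wordCylinder_iff_get.2 fun i hi => ?_)
      have hi' : i < x.toWord.length + 1 := by simpa using hi
      have e : p.1.1.letter i = p.1.2.letter i := by
        by_contra hne
        have : commonLength p ≤ i := Nat.sInf_le hne
        omega
      rw [e]
      have h3 : p.1.2 ∈ wordCylinder (x.toWord ++ [b]) := by
        rw [show x.toWord ++ b :: v = (x.toWord ++ [b]) ++ v by simp] at h2
        exact wordCylinder_append_subset _ _ h2
      exact mem_wordCylinder_iff_get.1 h3 i hi
    rw [← hy] at h2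
    have hlen : y.toWord.length = x.toWord.length + (v.length + 1) := by rw [hy]; simp
    refine ⟨γ, h, ((x.toWord.length - commonLength p : ℕ) : ℤ),
      ((y.toWord.length - commonLength p : ℕ) : ℤ), by omega, ?_, ?_⟩
    · rw [hp, Nat.add_sub_cancel' hL, mk_initial_eq hx2]
    · rw [hp, Nat.add_sub_cancel' (by omega), mk_initial_eq h2]

theorem exists_common_prefix : ∀ x y : List (α × Bool), ∃ c u v, x = c ++ u ∧ y = c ++ v ∧
    ∀ a ∈ u.head?, ∀ b ∈ v.head?, a ≠ b
  | [], y => ⟨[], [], y, by simp⟩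
  | x, [] => ⟨[], x, [], by simp⟩
  | a :: x, b :: y => by
    by_cases h : a = b
    · obtain ⟨c, u, v, h1, h2, h3⟩ := exists_common_prefix x y
      exact ⟨a :: c, u, v, by simp [h1], by simp [h, h2], h3⟩
    · exact ⟨[], a :: x, b :: y, by simp, by simp, by simpa using h⟩

/-- The uniform current of the cylinder of a segment `[x, y]` is the uniform measure of the cylinder
of `x⁻¹ * y`. -/
theorem uniformCurrent_segmentCylinder [Fintype α] {x y : FreeGroup α} (h : x ≠ y) :
    uniformCurrent α (segmentCylinder x y) = uniformMeasure α (cylinder (x⁻¹ * y)) := by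
  obtain ⟨c, u, v, hx, hy, huv⟩ := exists_common_prefix x.toWord y.toWord
  have hxy := toWord_inv_mul hx hy huv
  have hne : x⁻¹ * y ≠ 1 := fun e => h (inv_mul_eq_one.1 e)
  have hw : uniformMeasure α (cylinder (x⁻¹ * y)) = weight α (u.length + v.length) := by
    rw [uniformMeasure_cylinder hne, weight, FreeGroup.norm, hxy, List.length_append,
      FreeGroup.invRev_length]
  have hrx : FreeGroup.IsReduced (c ++ u) := hx ▸ FreeGroup.isReduced_toWord
  have hry : FreeGroup.IsReduced (c ++ v) := hy ▸ FreeGroup.isReduced_toWord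
  rw [hw]
  match u, v with
  | [], [] =>
    exact absurd (FreeGroup.toWord_injective (hx.trans hy.symm)) h
  | [], b :: v =>
    rw [List.append_nil] at hx
    rw [segmentCylinder_prefix (hx ▸ hy), hx, uniformCurrent_rect_compl_left hry]
    simp
  | a :: u, [] =>
    rw [List.append_nil] at hy
    have e : segmentCylinder x y =
        rect (wordCylinder (c ++ a :: u)) (wordCylinder (c ++ [a]))ᶜ := by
      ext p
      rw [mem_segmentCylinder_swap, segmentCylinder_prefix (hy ▸ hx), hy]
      exact and_comm
    rw [e, uniformCurrent_rect_compl_right hrx]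
    simp
  | a :: u, b :: v =>
    rw [segmentCylinder_diverging hx hy (by simpa using huv),
      uniformCurrent_rect (by simpa using huv) hrx hry]
    congr 1
    simp
    omega

end Geodesics
section Length

variable {α : Type*} [DecidableEq α]

/-- The length of a current: the measure of the base-ball. -/
noncomputable def currentLength (η : Measure (DoubleBoundary α)) : ℝ≥0∞ := η baseBall

/-- The length of an automorphism: the length of the image of the uniform current. -/
noncomputable def automorphismLength [Fintype α] (Φ : FreeGroup α ≃* FreeGroup α) : ℝ≥0∞ :=
  currentLength ((uniformCurrent α).map (doubleBoundaryMap Φ))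

/-- The cyclically reduced length of an element of the free group. -/
def cyclicLength (f : FreeGroup α) : ℕ := (FreeGroup.reduceCyclically f.toWord).length

end Length

end FreeGroupCurrent

/-! In rank at least 2 the proof gives, for each fixed `f`, a constant `c > 0` with `c * ‖Φ f‖ ≤
L(Φ)` whenever `f` is not a proper power; a general `f` is a power of a shorter root, and `‖x ^ e‖ =
e * ‖x‖`. In rank at most 1 automorphisms preserve word length.

The uniform current `η` is invariant under the group, so `L` is unchanged when `Φ` is composed with
an inner automorphism (`automorphismLength_conj_mul`). Hence both `f` and `g = Φ f` may be taken
cyclically reduced, and `‖Φ f‖ = |g|`. Let `V` be the set of lines that pass through `1` and then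
follow the axis of `g` for two periods (`axisCylinder`). The mass `η(Φ⁻¹ V)` is estimated from both
sides.

Upper estimate (`norm_mul_le_automorphismLength`): for the proper prefixes `u` of the word of `g`,
the translates `u⁻¹ V` consist of lines through `1`. They are pairwise disjoint, since the forward
ends start with different rotations of `g`, an element that is not a proper power. Invariance gives
their pullbacks equal mass, so `|g| * η(Φ⁻¹ V) ≤ η(Φ⁻¹ B) ≤ L(Φ)`.

Lower estimate (`axisBound_le`): take rays `ξ`, `ζ` with different first letters, both distinct from
the first letters of `f` and `f⁻¹`. The images of `ξ` and `ζ` leave the axis of `g` in some periods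
`m` and `n`, and that of `f ^ 5 * ζ` leaves it in period `n + 5`. Whatever `m` and `n` are, the
image of the line from `ξ` to `f ^ 5 * ζ` or of the line from `ζ` to `ξ` follows the axis long
enough to have a translate by a power of `g` in `V` (`exists_lineTranslate_mem_axisCylinder`). So
the translates of `Φ⁻¹ V` by powers of `f` cover a definite part of two product sets, neither of
which meets its own translates by nontrivial powers of `f`. This bounds `η(Φ⁻¹ V)` below by a
positive number depending only on `f` and the chosen letters. -/

namespace FreeGroupCurrent

/-! ### The action of the free group on its boundary and on lines. -/

section Translation

variable {α : Type*}

theorem Boundary.letter_eq_of_mem {ξ : Boundary α} {w : List (α × Bool)} {a : α × Bool}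
    (h : ξ ∈ wordCylinder w) (ha : w.head? = some a) : ξ.letter 0 = a := by
  cases w with
  | nil => simp at ha
  | cons b w =>
    obtain rfl : b = a := by simpa using ha
    exact mem_wordCylinder_iff_get.1 h 0 (by simp)

theorem Boundary.mem_singleton_iff {ξ : Boundary α} {a : α × Bool} :
    ξ ∈ wordCylinder [a] ↔ ξ.letter 0 = a := by
  rw [mem_wordCylinder_iff_get]
  simp

theorem eq_of_mem_wordCylinders {ξ ζ : Boundary α}
    (h : ∀ n, ∃ w : List (α × Bool), n ≤ w.length ∧ ξ ∈ wordCylinder w ∧ ζ ∈ wordCylinder w) :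
    ξ = ζ := by
  refine Boundary.ext_initial fun n => ?_
  obtain ⟨w, hn, h1, h2⟩ := h n
  rw [← ξ.take_initial hn, ← ζ.take_initial hn, mem_wordCylinder_iff.1 h1,
    mem_wordCylinder_iff.1 h2]

variable [DecidableEq α]

/-- Right multiplication by `c` can alter only the last `c.norm` letters of a long word, so it does
not affect limits. -/
theorem ConvergesTo.mul_right {g : ℕ → FreeGroup α} {ξ : Boundary α} (h : ConvergesTo g ξ)
    (c : FreeGroup α) : ConvergesTo (fun n => g n * c) ξ := by
  intro m
  filter_upwards [h (m + c.norm)] with n hn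
  have hl := hn.length_le
  rw [Boundary.length_initial] at hl
  have h2 : ξ.initial m <+: (g n).toWord := (ξ.initial_prefix (by omega)).trans hn
  have h3 := List.prefix_iff_eq_take.1 h2
  rw [Boundary.length_initial, ← take_mul' (g n) c hl] at h3
  rw [h3]
  exact List.take_prefix _ _

theorem isReduced_inv_append_letter {g : FreeGroup α} {a e : α × Bool} (ha : g.toWord.head? = some a)
    (he : e ≠ a) : FreeGroup.IsReduced (g⁻¹.toWord ++ [e]) := by
  rw [FreeGroup.IsReduced, List.isChain_append]
  refine ⟨FreeGroup.isReduced_toWord, by simp, ?_⟩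
  intro x hx y hy
  obtain ⟨u, hu⟩ : ∃ u, g.toWord = a :: u := List.head?_eq_some_iff.1 ha
  rw [FreeGroup.toWord_inv, hu] at hx
  have hx' : x = (a.1, !a.2) := by simpa [FreeGroup.invRev, eq_comm] using hx
  have hy' : e = y := by simpa using hy
  subst hx' hy'
  intro h
  obtain ⟨a1, a2⟩ := a
  obtain ⟨e1, e2⟩ := e
  simp only at h ⊢
  subst h
  cases a2 <;> cases e2 <;> simp_all

variable [Finite α]

/-- The action of the free group on its boundary by left multiplication. -/
noncomputable def translate (h : FreeGroup α) (ξ : Boundary α) : Boundary α :=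
  boundaryMap (MulAut.conj h) ξ

/-- Conjugation by `h` and left multiplication by `h` differ by a right multiplication, which limits
do not see. Defining the action through conjugation makes continuity and measurability instances of
the results on automorphisms. -/
theorem translate_spec (h : FreeGroup α) {g : ℕ → FreeGroup α} {ξ : Boundary α}
    (hg : ConvergesTo g ξ) : ConvergesTo (fun n => h * g n) (translate h ξ) := by
  have := (boundaryMap_spec (MulAut.conj h) hg).mul_right h
  simpa [translate, MulAut.conj_apply] using this

theorem translate_mul (g h : FreeGroup α) (ξ : Boundary α) :
    translate (g * h) ξ = translate g (translate h ξ) := by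
  have h1 := translate_spec (g * h) (convergesTo_vertex ξ)
  have h2 := translate_spec g (translate_spec h (convergesTo_vertex ξ))
  simp only [← mul_assoc] at h2
  exact h1.unique h2

@[simp]
theorem translate_one (ξ : Boundary α) : translate 1 ξ = ξ := by
  have h1 := translate_spec 1 (convergesTo_vertex ξ)
  simp only [one_mul] at h1
  exact h1.unique (convergesTo_vertex ξ)

@[simp]
theorem translate_inv_translate (g : FreeGroup α) (ξ : Boundary α) :
    translate g⁻¹ (translate g ξ) = ξ := by
  rw [← translate_mul]
  simp

@[simp]
theorem translate_translate_inv (g : FreeGroup α) (ξ : Boundary α) :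
    translate g (translate g⁻¹ ξ) = ξ := by
  rw [← translate_mul]
  simp

theorem boundaryMap_translate (Φ : FreeGroup α ≃* FreeGroup α) (h : FreeGroup α)
    (ξ : Boundary α) : boundaryMap Φ (translate h ξ) = translate (Φ h) (boundaryMap Φ ξ) := by
  have h1 := boundaryMap_spec Φ (translate_spec h (convergesTo_vertex ξ))
  have h2 := translate_spec (Φ h) (boundaryMap_spec Φ (convergesTo_vertex ξ))
  simp only [map_mul] at h1
  exact h1.unique h2

theorem continuous_translate (h : FreeGroup α) : Continuous (translate h) :=
  continuous_boundaryMap _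

/-- When nothing cancels between `h` and `v`, multiplication by `h` only prepends letters; `v` must
be nonempty to shield the junction from the letters that follow. -/
theorem translate_mem_wordCylinder {h : FreeGroup α} {v : List (α × Bool)} {ξ : Boundary α}
    (hr : FreeGroup.IsReduced (h.toWord ++ v)) (hv : v ≠ []) (hξ : ξ ∈ wordCylinder v) :
    translate h ξ ∈ wordCylinder (h.toWord ++ v) := by
  refine (translate_spec h (convergesTo_vertex ξ)).mem_wordCylinder ?_
  filter_upwards [(convergesTo_vertex ξ).eventually_prefix hξ] with n hn
  obtain ⟨t, ht⟩ := hn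
  have hred : FreeGroup.IsReduced (v ++ t) := ht ▸ FreeGroup.isReduced_toWord
  rw [FreeGroup.toWord_mul, ← ht, ← List.append_assoc, (hr.append_overlap hred hv).reduce_eq]
  exact List.prefix_append _ _

theorem translate_inv_mem_wordCylinder {h : FreeGroup α} {v : List (α × Bool)} {ξ : Boundary α}
    (hξ : ξ ∈ wordCylinder (h.toWord ++ v)) : translate h⁻¹ ξ ∈ wordCylinder v := by
  refine (translate_spec h⁻¹ (convergesTo_vertex ξ)).mem_wordCylinder ?_
  filter_upwards [(convergesTo_vertex ξ).eventually_prefix hξ] with n hn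
  obtain ⟨t, ht⟩ := hn
  have hred : FreeGroup.IsReduced (v ++ t) := by
    have : FreeGroup.IsReduced (h.toWord ++ v ++ t) := ht ▸ FreeGroup.isReduced_toWord
    rw [List.append_assoc] at this
    exact (List.isChain_append.1 this).2.1
  have e : h⁻¹ * FreeGroup.mk (ξ.initial n) = FreeGroup.mk (v ++ t) := by
    rw [← FreeGroup.mk_toWord (x := FreeGroup.mk (ξ.initial n)), ← ht, List.append_assoc,
      ← FreeGroup.mul_mk, FreeGroup.mk_toWord, inv_mul_cancel_left]
  rw [e, toWord_mk_of_isReduced hred]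
  exact List.prefix_append _ _

/-- A ray that does not start with `g⁻¹` is translated by `g` to one that starts with the first
letter of `g`. -/
theorem letter_translate {g : FreeGroup α} {a : α × Bool} {ξ : Boundary α}
    (ha : g.toWord.head? = some a) (hξ : ξ ∉ wordCylinder g⁻¹.toWord) :
    (translate g ξ).letter 0 = a := by
  by_contra he
  refine hξ ?_
  have := translate_mem_wordCylinder (isReduced_inv_append_letter ha he) (by simp)
    (Boundary.mem_singleton_iff.2 rfl)
  rw [translate_inv_translate] at this
  exact wordCylinder_append_subset _ _ this

theorem letter_translate_of_ne {g : FreeGroup α} {a z : α × Bool} {ξ : Boundary α}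
    (ha : g.toWord.head? = some a) (hz : g⁻¹.toWord.head? = some z) (hξ : ξ.letter 0 ≠ z) :
    (translate g ξ).letter 0 = a :=
  letter_translate ha fun h => hξ (Boundary.letter_eq_of_mem h hz)

/-- Here and below `a` and `z` are the first letters of `g` and `g⁻¹`, so that `a ≠ z` expresses
that `g` is cyclically reduced. A ray starting with `a` then does not start with `z`, so each
further application of `g` again gives a ray starting with `a`. -/
theorem letter_translate_pow {g : FreeGroup α} {a z : α × Bool} {ξ : Boundary α}
    (ha : g.toWord.head? = some a) (hz : g⁻¹.toWord.head? = some z) (haz : a ≠ z)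
    (hξ : ξ.letter 0 ≠ z) (n : ℕ) : (translate (g ^ (n + 1)) ξ).letter 0 = a := by
  induction n with
  | zero => simpa using letter_translate_of_ne ha hz hξ
  | succ n ih =>
    rw [pow_succ', translate_mul]
    exact letter_translate_of_ne ha hz (ih ▸ haz)

/-- Ping-pong: a nontrivial power of `g` throws every ray outside the cylinders of `a` and `z` into
one of them. Sets of lines whose first ends share another first letter are therefore disjoint from
their translates. -/
theorem letter_translate_zpow {g : FreeGroup α} {a z : α × Bool} {ξ : Boundary α}
    (ha : g.toWord.head? = some a) (hz : g⁻¹.toWord.head? = some z) (haz : a ≠ z)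
    (hξa : ξ.letter 0 ≠ a) (hξz : ξ.letter 0 ≠ z) {t : ℤ} (ht : t ≠ 0) :
    (translate (g ^ t) ξ).letter 0 = a ∨ (translate (g ^ t) ξ).letter 0 = z := by
  rcases lt_or_gt_of_ne ht with h | h
  · obtain ⟨n, rfl⟩ : ∃ n : ℕ, t = -((n + 1 : ℕ) : ℤ) := ⟨(-t - 1).toNat, by omega⟩
    right
    rw [zpow_neg, zpow_natCast, ← inv_pow]
    exact letter_translate_pow hz (by rwa [inv_inv]) haz.symm hξa n
  · obtain ⟨n, rfl⟩ : ∃ n : ℕ, t = ((n + 1 : ℕ) : ℤ) := ⟨(t - 1).toNat, by omega⟩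
    left
    rw [zpow_natCast]
    exact letter_translate_pow ha hz haz hξz n

/-- The action of the free group on pairs of distinct boundary points. -/
noncomputable def lineTranslate (h : FreeGroup α) : DoubleBoundary α → DoubleBoundary α :=
  doubleBoundaryMap (MulAut.conj h)

theorem lineTranslate_fst (h : FreeGroup α) (p : DoubleBoundary α) :
    (lineTranslate h p).1.1 = translate h p.1.1 := rfl

theorem lineTranslate_snd (h : FreeGroup α) (p : DoubleBoundary α) :
    (lineTranslate h p).1.2 = translate h p.1.2 := rfl

theorem measurable_lineTranslate (h : FreeGroup α) : Measurable (lineTranslate h) :=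
  measurable_doubleBoundaryMap _

theorem lineTranslate_mul (g h : FreeGroup α) (p : DoubleBoundary α) :
    lineTranslate (g * h) p = lineTranslate g (lineTranslate h p) :=
  Subtype.ext (Prod.ext (translate_mul g h _) (translate_mul g h _))

@[simp]
theorem lineTranslate_one (p : DoubleBoundary α) : lineTranslate 1 p = p :=
  Subtype.ext (Prod.ext (translate_one _) (translate_one _))

theorem doubleBoundaryMap_lineTranslate (Φ : FreeGroup α ≃* FreeGroup α) (h : FreeGroup α)
    (p : DoubleBoundary α) :
    doubleBoundaryMap Φ (lineTranslate h p) = lineTranslate (Φ h) (doubleBoundaryMap Φ p) :=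
  Subtype.ext (Prod.ext (boundaryMap_translate Φ h _) (boundaryMap_translate Φ h _))

end Translation

/-! ### Invariance of the uniform current under the free group. -/

section Invariance

variable {α : Type*}

/-- The pairs of boundary points with the same initial segments of length `n` as those of `p`. -/
def cell (p : DoubleBoundary α) (n : ℕ) : Set (DoubleBoundary α) :=
  rect (wordCylinder (p.1.1.initial n)) (wordCylinder (p.1.2.initial n))

theorem mem_cell {p q : DoubleBoundary α} {n : ℕ} :
    q ∈ cell p n ↔ q.1.1.initial n = p.1.1.initial n ∧ q.1.2.initial n = p.1.2.initial n := by
  simp [cell, rect, wordCylinder, Boundary.length_initial]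

theorem mem_cell_self (p : DoubleBoundary α) (n : ℕ) : p ∈ cell p n :=
  mem_cell.2 ⟨rfl, rfl⟩

theorem cell_eq {p q : DoubleBoundary α} {n : ℕ} (h : q ∈ cell p n) : cell p n = cell q n := by
  rw [mem_cell] at h
  rw [cell, cell, h.1, h.2]

theorem cell_anti (p : DoubleBoundary α) {m n : ℕ} (h : m ≤ n) : cell p n ⊆ cell p m := by
  intro q hq
  rw [mem_cell] at hq ⊢
  rw [← q.1.1.take_initial h, ← q.1.2.take_initial h, hq.1, hq.2, Boundary.take_initial _ h,
    Boundary.take_initial _ h]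
  exact ⟨rfl, rfl⟩

/-- The cells that are products of two disjoint cylinders. -/
def cells (α : Type*) : Set (Set (DoubleBoundary α)) :=
  {s | ∃ p n, p.1.1.initial n ≠ p.1.2.initial n ∧ s = cell p n}

/-- Two cells with a common point `r` are both cells around `r`, hence nested. -/
theorem isPiSystem_cells : IsPiSystem (cells α) := by
  rintro _ ⟨p, m, hp, rfl⟩ _ ⟨q, n, hq, rfl⟩ ⟨r, hr1, hr2⟩
  rw [cell_eq hr1, cell_eq hr2]
  rw [mem_cell] at hr1 hr2
  rw [← hr1.1, ← hr1.2] at hp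
  rw [← hr2.1, ← hr2.2] at hq
  rcases le_total m n with h | h
  · exact ⟨r, n, hq, Set.inter_eq_right.2 (cell_anti r h)⟩
  · exact ⟨r, m, hp, Set.inter_eq_left.2 (cell_anti r h)⟩

theorem countable_cells [Countable α] : (cells α).Countable := by
  refine (Set.countable_range fun w : List (α × Bool) × List (α × Bool) =>
    (rect (wordCylinder w.1) (wordCylinder w.2) : Set (DoubleBoundary α))).mono ?_
  rintro _ ⟨p, n, -, rfl⟩
  exact ⟨(p.1.1.initial n, p.1.2.initial n), rfl⟩

theorem exists_initial_ne (p : DoubleBoundary α) :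
    ∃ N, ∀ n, N ≤ n → p.1.1.initial n ≠ p.1.2.initial n := by
  obtain ⟨N, hN⟩ : ∃ N, p.1.1.initial N ≠ p.1.2.initial N := by
    by_contra! h
    exact p.2 (Boundary.ext_initial h)
  refine ⟨N, fun n hn h => hN ?_⟩
  rw [← p.1.1.take_initial hn, ← p.1.2.take_initial hn, h]

/-- The conclusion is for all large `n` because a cell uses the same `n` at both ends. -/
theorem exists_cylinder_subset {U : Set (Boundary α)} (hU : IsOpen U) {ξ : Boundary α}
    (h : ξ ∈ U) : ∃ N, ∀ n, N ≤ n → wordCylinder (ξ.initial n) ⊆ U := by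
  induction hU with
  | basic s hs =>
    obtain ⟨w, rfl⟩ := hs
    refine ⟨w.length, fun n hn ζ hζ => ?_⟩
    rw [mem_wordCylinder_iff, Boundary.length_initial] at hζ
    change ζ.initial w.length = w
    rw [← ζ.take_initial hn, hζ, ξ.take_initial hn]
    exact h
  | univ => exact ⟨0, fun _ _ => Set.subset_univ _⟩
  | inter s t _ _ hs ht =>
    obtain ⟨M, hM⟩ := hs h.1
    obtain ⟨N, hN⟩ := ht h.2
    exact ⟨max M N, fun n hn => Set.subset_inter (hM n (le_of_max_le_left hn))
      (hN n (le_of_max_le_right hn))⟩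
  | sUnion S _ ih =>
    obtain ⟨s, hs, hx⟩ := h
    obtain ⟨N, hN⟩ := ih s hs hx
    exact ⟨N, fun n hn => (hN n hn).trans (Set.subset_sUnion_of_mem hs)⟩

theorem isOpen_cell (p : DoubleBoundary α) (n : ℕ) : IsOpen (cell p n) :=
  ((isOpen_wordCylinder _).prod (isOpen_wordCylinder _)).preimage continuous_subtype_val

theorem isTopologicalBasis_cells : TopologicalSpace.IsTopologicalBasis (cells α) := by
  refine TopologicalSpace.isTopologicalBasis_of_isOpen_of_nhds ?_ ?_
  · rintro _ ⟨p, n, -, rfl⟩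
    exact isOpen_cell p n
  · intro p O hp hO
    obtain ⟨O', hO', rfl⟩ := isOpen_induced_iff.1 hO
    obtain ⟨U, V, hU, hV, h1, h2, hUV⟩ := isOpen_prod_iff.1 hO' p.1.1 p.1.2 hp
    obtain ⟨L, hL⟩ := exists_initial_ne p
    obtain ⟨M, hM⟩ := exists_cylinder_subset hU h1
    obtain ⟨N, hN⟩ := exists_cylinder_subset hV h2
    refine ⟨cell p (max L (max M N)), ⟨p, _, hL _ (le_max_left _ _), rfl⟩, mem_cell_self _ _, ?_⟩
    intro q hq
    exact hUV ⟨hM _ (by omega) hq.1, hN _ (by omega) hq.2⟩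

theorem borel_eq_generateFrom_cells [Countable α] :
    (inferInstance : MeasurableSpace (DoubleBoundary α)) =
      MeasurableSpace.generateFrom (cells α) := by
  have := isTopologicalBasis_cells.secondCountableTopology (countable_cells (α := α))
  rw [← isTopologicalBasis_cells.borel_eq_generateFrom]
  exact BorelSpace.measurable_eq

variable [DecidableEq α]

/-- Two different words of the same length diverge before either ends, so only the diverging case of
segment cylinders occurs. -/
theorem cell_eq_segmentCylinder {p : DoubleBoundary α} {n : ℕ}
    (h : p.1.1.initial n ≠ p.1.2.initial n) :
    cell p n = segmentCylinder (FreeGroup.mk (p.1.1.initial n))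
      (FreeGroup.mk (p.1.2.initial n)) := by
  obtain ⟨c, u, v, hu, hv, huv⟩ := exists_common_prefix (p.1.1.initial n) (p.1.2.initial n)
  have hl1 := congrArg List.length hu
  have hl2 := congrArg List.length hv
  simp only [Boundary.length_initial, List.length_append] at hl1 hl2
  match u, v with
  | [], [] => exact absurd (hu.trans hv.symm) h
  | [], b :: v => simp at hl1 hl2; omega
  | a :: u, [] => simp at hl1 hl2; omega
  | a :: u, b :: v =>
    rw [segmentCylinder_diverging ((toWord_vertex _ _).trans hu) ((toWord_vertex _ _).trans hv)
      (by simpa using huv), cell, hu, hv]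

theorem lineTranslate_mem_segmentCylinder [Finite α] {h x y : FreeGroup α} {p : DoubleBoundary α}
    (hp : p ∈ segmentCylinder x y) : lineTranslate h p ∈ segmentCylinder (h * x) (h * y) := by
  obtain ⟨γ, hγ, i, j, hij, rfl, rfl⟩ := hp
  refine ⟨fun n => h * γ n, ⟨fun i j => ?_, translate_spec h hγ.left, translate_spec h hγ.right⟩,
    i, j, hij, rfl, rfl⟩
  rw [← hγ.isometry]
  congr 2
  group

theorem lineTranslate_preimage_segmentCylinder [Finite α] (h x y : FreeGroup α) :
    lineTranslate h ⁻¹' segmentCylinder x y = segmentCylinder (h⁻¹ * x) (h⁻¹ * y) := by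
  ext p
  constructor
  · intro hp
    have := lineTranslate_mem_segmentCylinder (h := h⁻¹) hp
    rwa [← lineTranslate_mul, inv_mul_cancel, lineTranslate_one] at this
  · intro hp
    have := lineTranslate_mem_segmentCylinder (h := h) hp
    rwa [mul_inv_cancel_left, mul_inv_cancel_left] at this

theorem uniformCurrent_lineTranslate_segmentCylinder [Fintype α] (h : FreeGroup α)
    {x y : FreeGroup α} (hxy : x ≠ y) :
    uniformCurrent α (lineTranslate h ⁻¹' segmentCylinder x y) =
      uniformCurrent α (segmentCylinder x y) := by
  rw [lineTranslate_preimage_segmentCylinder, uniformCurrent_segmentCylinder hxy,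
    uniformCurrent_segmentCylinder (by simpa using hxy)]
  congr 2
  group

/-- The uniform current is invariant under the action of the free group. -/
theorem map_lineTranslate_uniformCurrent [Fintype α] (h : FreeGroup α) :
    (uniformCurrent α).map (lineTranslate h) = uniformCurrent α := by
  have hne : ∀ {p : DoubleBoundary α} {n : ℕ}, p.1.1.initial n ≠ p.1.2.initial n →
      FreeGroup.mk (p.1.1.initial n) ≠ FreeGroup.mk (p.1.2.initial n) := by
    intro p n hp e
    have := congrArg FreeGroup.toWord e
    rw [toWord_vertex, toWord_vertex] at this
    exact hp this
  have hS : ∀ s ∈ cells α, (uniformCurrent α).map (lineTranslate h) s = uniformCurrent α s := by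
    rintro _ ⟨p, n, hp, rfl⟩
    rw [Measure.map_apply (measurable_lineTranslate h) (isOpen_cell p n).measurableSet,
      cell_eq_segmentCylinder hp, uniformCurrent_lineTranslate_segmentCylinder h (hne hp)]
  -- The total mass may be infinite near the diagonal, so uniqueness needs a countable cover by sets
  -- of finite mass; the cells themselves provide it.
  refine Measure.ext_of_generateFrom_of_cover_subset borel_eq_generateFrom_cells
    isPiSystem_cells subset_rfl countable_cells ?_ ?_ hS
  · refine Set.eq_univ_of_forall fun p => ?_
    obtain ⟨N, hN⟩ := exists_initial_ne p
    exact ⟨_, ⟨p, N, hN N le_rfl, rfl⟩, mem_cell_self p N⟩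
  · intro s hs
    rw [hS s hs]
    obtain ⟨p, n, hp, rfl⟩ := hs
    rw [cell_eq_segmentCylinder hp, uniformCurrent_segmentCylinder (hne hp)]
    exact measure_ne_top _ _

theorem uniformCurrent_lineTranslate_preimage [Fintype α] (h : FreeGroup α)
    {s : Set (DoubleBoundary α)} (hs : MeasurableSet s) :
    uniformCurrent α (lineTranslate h ⁻¹' s) = uniformCurrent α s := by
  conv_rhs => rw [← map_lineTranslate_uniformCurrent h,
    Measure.map_apply (measurable_lineTranslate h) hs]

end Invariance

/-! ### Rays and lines relative to the axis of a cyclically reduced element. -/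

section Axis

variable {α : Type*} [DecidableEq α]

theorem isReduced_append_self {g : FreeGroup α} {a z : α × Bool}
    (hz : g⁻¹.toWord.head? = some z) (haz : a ≠ z)
    {w : List (α × Bool)} (hw : FreeGroup.IsReduced w) (hwa : w.head? = some a) :
    FreeGroup.IsReduced (g.toWord ++ w) := by
  obtain ⟨u, rfl⟩ := List.head?_eq_some_iff.1 hwa
  have h := isReduced_inv_append_letter hz haz
  rw [inv_inv] at h
  simpa using h.append_overlap (L₃ := u) (by simpa using hw) (by simp)

theorem toWord_pow_succ {g : FreeGroup α} {a z : α × Bool}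
    (ha : g.toWord.head? = some a) (hz : g⁻¹.toWord.head? = some z) (haz : a ≠ z) (n : ℕ) :
    (g ^ (n + 1)).toWord = g.toWord ++ (g ^ n).toWord ∧ (g ^ (n + 1)).toWord.head? = some a := by
  obtain ⟨u, hu⟩ := List.head?_eq_some_iff.1 ha
  induction n with
  | zero => simp [hu]
  | succ n ih =>
    have h : (g ^ (n + 1 + 1)).toWord = g.toWord ++ (g ^ (n + 1)).toWord := by
      rw [pow_succ' g (n + 1), FreeGroup.toWord_mul,
        (isReduced_append_self hz haz FreeGroup.isReduced_toWord ih.2).reduce_eq]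
    exact ⟨h, by simp [h, hu]⟩

theorem le_norm_pow {g : FreeGroup α} {a z : α × Bool}
    (ha : g.toWord.head? = some a) (hz : g⁻¹.toWord.head? = some z) (haz : a ≠ z) (n : ℕ) :
    n ≤ (g ^ n).toWord.length := by
  obtain ⟨u, hu⟩ := List.head?_eq_some_iff.1 ha
  induction n with
  | zero => simp
  | succ n ih =>
    rw [(toWord_pow_succ ha hz haz n).1, hu]
    simp
    omega

variable [Finite α]

theorem translate_mem_wordCylinder_pow {g : FreeGroup α} {a z : α × Bool}
    (ha : g.toWord.head? = some a) (hz : g⁻¹.toWord.head? = some z) (haz : a ≠ z)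
    {ξ : Boundary α} {n : ℕ} (h : ξ ∈ wordCylinder (g ^ (n + 1)).toWord) :
    translate g ξ ∈ wordCylinder (g ^ (n + 2)).toWord := by
  have h1 := (toWord_pow_succ ha hz haz n).2
  rw [(toWord_pow_succ ha hz haz (n + 1)).1]
  refine translate_mem_wordCylinder
    (isReduced_append_self hz haz FreeGroup.isReduced_toWord h1) ?_ h
  intro h2
  simp [h2] at h1

/-- Such a ray starts with every power of `g`, so it is the attracting end of the axis: it and its
translate by `g` share arbitrarily long prefixes. -/
theorem translate_eq_of_forall_mem {g : FreeGroup α} {a z : α × Bool}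
    (ha : g.toWord.head? = some a) (hz : g⁻¹.toWord.head? = some z) (haz : a ≠ z)
    {ξ : Boundary α} (h : ∀ n : ℕ, translate (g ^ n)⁻¹ ξ ∈ wordCylinder g.toWord) :
    translate g ξ = ξ := by
  have key : ∀ n : ℕ, ∀ ζ ∈ wordCylinder g.toWord,
      translate (g ^ n) ζ ∈ wordCylinder (g ^ (n + 1)).toWord := by
    intro n
    induction n with
    | zero => intro ζ hζ; simpa using hζ
    | succ n ih =>
      intro ζ hζ
      rw [pow_succ' g n, translate_mul]
      exact translate_mem_wordCylinder_pow ha hz haz (ih ζ hζ)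
  have hmem : ∀ n : ℕ, ξ ∈ wordCylinder (g ^ (n + 1)).toWord := by
    intro n
    have := key n _ (h n)
    rwa [translate_translate_inv] at this
  refine eq_of_mem_wordCylinders fun n => ⟨(g ^ (n + 2)).toWord, ?_, ?_, hmem (n + 1)⟩
  · exact (Nat.le_add_right n 2).trans (le_norm_pow ha hz haz (n + 2))
  · exact translate_mem_wordCylinder_pow ha hz haz (hmem n)

/-- A ray that is not an end of the axis of `g` leaves the axis in some period. -/
theorem exists_period {g : FreeGroup α} {a z : α × Bool}
    (ha : g.toWord.head? = some a) (hz : g⁻¹.toWord.head? = some z) (haz : a ≠ z)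
    {ξ : Boundary α} (hξ : translate g ξ ≠ ξ) :
    ∃ m : ℤ, ∀ j : ℤ, translate (g ^ (-j)) ξ ∈ wordCylinder g.toWord ↔ j ≤ m := by
  have step : ∀ j : ℤ, translate (g ^ (-(j + 1))) ξ ∈ wordCylinder g.toWord →
      translate (g ^ (-j)) ξ ∈ wordCylinder g.toWord := by
    intro j hj
    have h1 := translate_mem_wordCylinder_pow ha hz haz (n := 0) (by rwa [zero_add, pow_one])
    rw [← translate_mul, ← zpow_one_add, (toWord_pow_succ ha hz haz 1).1,
      show 1 + -(j + 1) = -j by ring, pow_one] at h1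
    exact wordCylinder_append_subset _ _ h1
  have mono : ∀ (n : ℕ) (j : ℤ), translate (g ^ (-(j + n))) ξ ∈ wordCylinder g.toWord →
      translate (g ^ (-j)) ξ ∈ wordCylinder g.toWord := by
    intro n
    induction n with
    | zero => intro j hj; simpa using hj
    | succ n ih =>
      intro j hj
      refine ih j (step _ ?_)
      rwa [Nat.cast_succ, ← add_assoc] at hj
  have mono' : ∀ i j : ℤ, i ≤ j → translate (g ^ (-j)) ξ ∈ wordCylinder g.toWord →
      translate (g ^ (-i)) ξ ∈ wordCylinder g.toWord := by
    intro i j hij hj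
    refine mono (j - i).toNat i ?_
    rwa [show i + ((j - i).toNat : ℤ) = j by omega]
  have hout : ∃ j : ℤ, translate (g ^ (-j)) ξ ∉ wordCylinder g.toWord := by
    by_contra! h
    refine hξ (translate_eq_of_forall_mem ha hz haz fun n => ?_)
    simpa using h n
  -- If no translate starts with `g`, then all translates by `g ^ n` with `n ≥ 0` start with `g⁻¹`:
  -- otherwise `g ^ (n + 1)` would take `ξ` to a ray starting with `a`, while the absence of `g` at
  -- exponent `n + 2` makes that ray start with `z`. So `ξ` would be the repelling end, which `g`
  -- fixes.
  have hin : ∃ j : ℤ, translate (g ^ (-j)) ξ ∈ wordCylinder g.toWord := by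
    by_contra! h
    have h1 : translate g⁻¹ ξ = ξ := by
      refine translate_eq_of_forall_mem hz (by rwa [inv_inv]) haz.symm fun n => ?_
      by_contra h5
      have h6 := letter_translate (g := g) (ξ := translate (g ^ (n : ℤ)) ξ) ha
        (by simpa using h5)
      have h7 := letter_translate (g := g⁻¹) (ξ := translate (g ^ ((n : ℤ) + 2)) ξ) hz
          (by simpa only [inv_inv, neg_neg] using h (-((n : ℤ) + 2)))
      rw [← translate_mul, ← zpow_neg_one, ← zpow_add,
          show (-1 : ℤ) + (n + 2) = 1 + n by ring, zpow_one_add, translate_mul, h6] at h7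
      exact haz h7
    apply hξ
    conv_lhs => rw [← h1]
    simp
  obtain ⟨j₀, hj₀⟩ := hout
  obtain ⟨m, hm1, hm2⟩ := Int.exists_greatest_of_bdd
    (P := fun j => translate (g ^ (-j)) ξ ∈ wordCylinder g.toWord)
    ⟨j₀, fun j hj => by
      by_contra! hlt
      exact hj₀ (mono' _ _ hlt.le hj)⟩ hin
  exact ⟨m, fun j => ⟨hm2 j, fun hj => mono' _ _ hj hm1⟩⟩

/-- The geodesics that pass through `1` and then follow the axis of `g`, whose word starts with `a`,
for two periods. -/
def axisCylinder (g : FreeGroup α) (a : α × Bool) : Set (DoubleBoundary α) :=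
  rect {ξ | ξ.letter 0 ≠ a} (wordCylinder (g.toWord ++ g.toWord))

/-- In period `m + 1` the first end may still share some letters with `g`; one period later it
branches off behind the base vertex, with first letter `z`. Together with the two periods to be
followed this accounts for the gap `3`. -/
theorem lineTranslate_mem_axisCylinder {g : FreeGroup α} {a z : α × Bool}
    (ha : g.toWord.head? = some a) (hz : g⁻¹.toWord.head? = some z) (haz : a ≠ z)
    {p : DoubleBoundary α} {m n : ℤ} (hmn : m + 3 ≤ n)
    (hm : ∀ j : ℤ, translate (g ^ (-j)) p.1.1 ∈ wordCylinder g.toWord ↔ j ≤ m)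
    (hn : ∀ j : ℤ, translate (g ^ (-j)) p.1.2 ∈ wordCylinder g.toWord ↔ j ≤ n) :
    lineTranslate (g ^ (-(m + 2))) p ∈ axisCylinder g a := by
  constructor
  · have h1 : translate (g ^ (-(m + 1))) p.1.1 ∉ wordCylinder g.toWord := by
      rw [hm]; omega
    have h2 := letter_translate (g := g⁻¹) hz (by rwa [inv_inv])
    rw [← translate_mul, ← zpow_neg_one, ← zpow_add, show (-1 : ℤ) + -(m + 1) = -(m + 2) by ring]
      at h2
    change (translate _ _).letter 0 ≠ a
    rw [h2]
    exact haz.symm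
  · have h1 : translate (g ^ (-(m + 3))) p.1.2 ∈ wordCylinder g.toWord := (hn _).2 hmn
    have h2 := translate_mem_wordCylinder_pow ha hz haz (n := 0) (by rwa [zero_add, pow_one])
    rw [← translate_mul, ← zpow_one_add, (toWord_pow_succ ha hz haz 1).1,
      show 1 + -(m + 3) = -(m + 2) by ring, pow_one] at h2
    exact h2

/-- Of the two lines from `ξ` to `g ^ 5 * ζ` and from `ζ` to `ξ`, one follows the axis of `g`
for two periods. -/
theorem exists_lineTranslate_mem_axisCylinder {g : FreeGroup α} {a z : α × Bool}
    (ha : g.toWord.head? = some a) (hz : g⁻¹.toWord.head? = some z) (haz : a ≠ z)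
    {p q : DoubleBoundary α} (h1 : translate g p.1.1 ≠ p.1.1) (h2 : translate g q.1.1 ≠ q.1.1)
    (h3 : q.1.2 = p.1.1) (h4 : p.1.2 = translate (g ^ 5) q.1.1) :
    ∃ t : ℤ, lineTranslate (g ^ t) p ∈ axisCylinder g a ∨
      lineTranslate (g ^ t) q ∈ axisCylinder g a := by
  obtain ⟨m, hm⟩ := exists_period ha hz haz h1
  obtain ⟨n, hn⟩ := exists_period ha hz haz h2
  -- The exponent `5` makes the alternatives exhaustive: if `m + 3 ≤ n + 5` fails, then `n + 3 ≤ m`,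
  -- the gap needed for the line from `ζ` to `ξ`.
  rcases le_or_gt (m + 3) (n + 5) with h | h
  · refine ⟨_, Or.inl (lineTranslate_mem_axisCylinder ha hz haz h hm fun j => ?_)⟩
    have := hn (j - 5)
    rw [h4, ← translate_mul, ← zpow_natCast, ← zpow_add,
      show -j + ((5 : ℕ) : ℤ) = -(j - 5) by push_cast; ring, this]
    omega
  · exact ⟨_, Or.inr (lineTranslate_mem_axisCylinder ha hz haz (by omega) hn (h3 ▸ hm))⟩

end Axis

/-! ### Lower bound for the current of a set whose translates meet enough lines. -/

section LowerBound

variable {α : Type*}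

theorem commonLength_eq_zero {p : DoubleBoundary α} (h : p.1.1.letter 0 ≠ p.1.2.letter 0) :
    commonLength p = 0 :=
  Nat.le_zero.1 (Nat.sInf_le h)

theorem measurableEmbedding_val [Countable α] :
    MeasurableEmbedding (Subtype.val : DoubleBoundary α → Boundary α × Boundary α) :=
  MeasurableEmbedding.subtype_coe (isClosed_diagonal (X := Boundary α)).measurableSet.compl

/-- The density of the uniform current on the pairs of points with different first letters. -/
noncomputable def baseDensity (α : Type*) [Fintype α] : ℝ≥0∞ :=
  ((2 * Fintype.card α : ℕ) : ℝ≥0∞) / ((2 * Fintype.card α - 1 : ℕ) : ℝ≥0∞)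

/-- Away from a common first letter the density is constant, so there the current is a multiple of
the product measure. -/
theorem uniformCurrent_eq_of_letter_ne [Fintype α] {E : Set (DoubleBoundary α)}
    (hE : MeasurableSet E) (h : ∀ p ∈ E, p.1.1.letter 0 ≠ p.1.2.letter 0) :
    uniformCurrent α E = baseDensity α *
      ((uniformMeasure α).prod (uniformMeasure α)) (Subtype.val '' E) := by
  rw [uniformCurrent, withDensity_apply _ hE,
    setLIntegral_congr_fun hE (g := fun _ => baseDensity α)
      (fun p hp => by simp [commonLength_eq_zero (h p hp), baseDensity]),
    setLIntegral_const, measurableEmbedding_val.comap_apply]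

theorem val_image_rect {A B : Set (Boundary α)}
    (h : ∀ ξ ∈ A, ∀ ζ ∈ B, ξ.letter 0 ≠ ζ.letter 0) :
    Subtype.val '' (rect A B) = A ×ˢ B := by
  ext ⟨ξ, ζ⟩
  constructor
  · rintro ⟨p, hp, e⟩
    rw [← e]
    exact hp
  · rintro ⟨h1, h2⟩
    exact ⟨⟨(ξ, ζ), fun e => h ξ h1 ζ h2 (congrArg (fun θ : Boundary α => θ.letter 0) e)⟩,
      ⟨h1, h2⟩, rfl⟩

theorem uniformCurrent_rect_of_letter_ne [Fintype α] {A B : Set (Boundary α)}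
    (hA : MeasurableSet A) (hB : MeasurableSet B)
    (h : ∀ ξ ∈ A, ∀ ζ ∈ B, ξ.letter 0 ≠ ζ.letter 0) :
    uniformCurrent α (rect A B) = baseDensity α * (uniformMeasure α A * uniformMeasure α B) := by
  rw [uniformCurrent_eq_of_letter_ne (measurableSet_rect hA hB) fun p hp => h _ hp.1 _ hp.2,
    val_image_rect h, Measure.prod_prod]

theorem measurableSet_letter (a : α × Bool) : MeasurableSet {ξ : Boundary α | ξ.letter 0 = a} := by
  have : {ξ : Boundary α | ξ.letter 0 = a} = wordCylinder [a] :=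
    Set.ext fun ξ => Boundary.mem_singleton_iff.symm
  rw [this]
  exact measurableSet_wordCylinder _

theorem baseDensity_ne_zero [Fintype α] [Nonempty α] : baseDensity α ≠ 0 := by
  have := Fintype.card_pos (α := α)
  refine ENNReal.div_ne_zero.2 ⟨?_, ENNReal.natCast_ne_top _⟩
  exact_mod_cast (by omega : 2 * Fintype.card α ≠ 0)

theorem baseDensity_ne_top [Fintype α] [Nonempty α] : baseDensity α ≠ ∞ := by
  have := Fintype.card_pos (α := α)
  refine ENNReal.div_ne_top (ENNReal.natCast_ne_top _) ?_
  exact_mod_cast (by omega : 2 * Fintype.card α - 1 ≠ 0)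

theorem uniformMeasure_wordCylinder_ne_zero [Fintype α] {w : List (α × Bool)}
    (hw : FreeGroup.IsReduced w) (h0 : w ≠ []) : uniformMeasure α (wordCylinder w) ≠ 0 := by
  rw [uniformMeasure_wordCylinder hw h0]
  exact ENNReal.inv_ne_zero.2 (ENNReal.natCast_ne_top _)

theorem uniformMeasure_le_one [Finite α] [Nonempty α] (A : Set (Boundary α)) :
    uniformMeasure α A ≤ 1 :=
  (measure_mono (Set.subset_univ A)).trans uniformMeasure_univ.le

variable [DecidableEq α]

/-- The mass of a union of translates of a set, inside a set that is disjoint from its own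
translates. -/
theorem measure_iUnion_inter_le [Fintype α] (f : FreeGroup α) {V U : Set (DoubleBoundary α)}
    (hV : MeasurableSet V) (hU : MeasurableSet U)
    (hdisj : ∀ p ∈ U, ∀ t : ℤ, t ≠ 0 → lineTranslate (f ^ t) p ∉ U) :
    uniformCurrent α ((⋃ t : ℤ, lineTranslate (f ^ t) ⁻¹' V) ∩ U) ≤ uniformCurrent α V := by
  have hm : ∀ (t : ℤ) {s : Set (DoubleBoundary α)}, MeasurableSet s →
      MeasurableSet (lineTranslate (f ^ t) ⁻¹' s) := fun t s hs => measurable_lineTranslate _ hs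
  have hback : ∀ (t : ℤ) p, lineTranslate (f ^ t) (lineTranslate (f ^ (-t)) p) = p := by
    intro t p
    rw [← lineTranslate_mul, ← zpow_add, add_neg_cancel, zpow_zero, lineTranslate_one]
  -- Each piece of `U` is carried back into `V`, where the pieces become disjoint because the
  -- translates of `U` are.
  have e : ∀ t : ℤ, uniformCurrent α (lineTranslate (f ^ t) ⁻¹' V ∩ U) =
      uniformCurrent α (V ∩ lineTranslate (f ^ (-t)) ⁻¹' U) := by
    intro t
    rw [← uniformCurrent_lineTranslate_preimage (f ^ (-t)) ((hm t hV).inter hU)]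
    congr 1
    ext p
    simp only [Set.mem_preimage, Set.mem_inter_iff, hback]
  rw [Set.iUnion_inter]
  calc uniformCurrent α (⋃ t : ℤ, lineTranslate (f ^ t) ⁻¹' V ∩ U)
      ≤ ∑' t : ℤ, uniformCurrent α (lineTranslate (f ^ t) ⁻¹' V ∩ U) := measure_iUnion_le _
    _ = ∑' t : ℤ, uniformCurrent α (V ∩ lineTranslate (f ^ (-t)) ⁻¹' U) := by simp_rw [e]
    _ = uniformCurrent α (⋃ t : ℤ, V ∩ lineTranslate (f ^ (-t)) ⁻¹' U) := by
        refine (measure_iUnion ?_ fun t => hV.inter (hm _ hU)).symm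
        intro s t hst
        refine Set.disjoint_left.2 fun p hp hp' => hdisj _ hp.2 (s - t) (by omega) ?_
        rw [← lineTranslate_mul, ← zpow_add, show s - t + -s = -t by ring]
        exact hp'.2
    _ ≤ uniformCurrent α V := measure_mono (Set.iUnion_subset fun _ => Set.inter_subset_left)

/-- Translates of subsets of a cylinder have proportional uniform measures. -/
theorem uniformMeasure_translate [Fintype α] [Nonempty α] {h : FreeGroup α} {a z b b' : α × Bool}
    (ha : h.toWord.head? = some a) (hz : h⁻¹.toWord.head? = some z)
    (hb : b ≠ a) (hb' : b' ≠ z) {A : Set (Boundary α)}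
    (hA : MeasurableSet A) (hA' : ∀ ξ ∈ A, ξ.letter 0 = b') :
    uniformMeasure α {ξ | ξ.letter 0 = b} * uniformMeasure α (translate h⁻¹ ⁻¹' A) =
      uniformMeasure α (translate h ⁻¹' {ξ | ξ.letter 0 = b}) * uniformMeasure α A := by
  have hz' : h⁻¹⁻¹.toWord.head? = some a := by rwa [inv_inv]
  have hA2 : MeasurableSet (translate h⁻¹ ⁻¹' A) := (continuous_translate _).measurable hA
  have hC : MeasurableSet (translate h ⁻¹' {ξ | ξ.letter 0 = b}) :=
    (continuous_translate _).measurable (measurableSet_letter b)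
  have h1 := uniformCurrent_rect_of_letter_ne (measurableSet_letter b) hA2 (by
    intro ξ hξ ζ hζ
    have := letter_translate_of_ne ha hz (ξ := translate h⁻¹ ζ) (by rwa [hA' _ hζ])
    rw [translate_translate_inv] at this
    rw [this, show ξ.letter 0 = b from hξ]
    exact hb)
  have h2 := uniformCurrent_rect_of_letter_ne hC hA (by
    intro ξ hξ ζ hζ
    have := letter_translate_of_ne hz hz' (ξ := translate h ξ)
      (by rwa [show (translate h ξ).letter 0 = b from hξ])
    rw [translate_inv_translate] at this
    rw [this, hA' _ hζ]
    exact hb'.symm)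
  -- With `C` the cylinder of `b`, translation by `h` matches `h⁻¹ C × A` with `C × h A`. Invariance
  -- gives them the same current, and on both the first letters differ, so the density cancels.
  have h3 : lineTranslate h ⁻¹' (rect {ξ | ξ.letter 0 = b} (translate h⁻¹ ⁻¹' A)) =
      rect (translate h ⁻¹' {ξ | ξ.letter 0 = b}) A := by
    ext p
    simp [rect, lineTranslate_fst, lineTranslate_snd]
  rw [← uniformCurrent_lineTranslate_preimage h
    (measurableSet_rect (measurableSet_letter b) hA2), h3, h2] at h1
  exact ((ENNReal.mul_right_inj baseDensity_ne_zero baseDensity_ne_top).1 h1).symm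

/-- The lower bound for the uniform current of a set whose translates by the powers of `f` meet, for
all `ξ` and `ζ` with given first letters, one of the lines from `ξ` to `f ^ 5 * ζ` and from
`ζ` to `ξ`. -/
noncomputable def axisBound [Fintype α] (f : FreeGroup α) (b b' : α × Bool) : ℝ≥0∞ :=
  baseDensity α * uniformMeasure α (translate (f ^ 5) ⁻¹' {ξ | ξ.letter 0 = b}) *
    (uniformMeasure α {ξ | ξ.letter 0 = b} * uniformMeasure α {ξ | ξ.letter 0 = b'}) / 2

theorem axisBound_ne_zero [Fintype α] {f : FreeGroup α} {a z b b' : α × Bool}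
    (ha : f.toWord.head? = some a) (hz : f⁻¹.toWord.head? = some z) (haz : a ≠ z)
    (hb : b ≠ a) : axisBound f b b' ≠ 0 := by
  have : Nonempty α := ⟨a.1⟩
  have hl : ∀ c : α × Bool, uniformMeasure α {ξ | ξ.letter 0 = c} ≠ 0 := by
    intro c
    have : {ξ : Boundary α | ξ.letter 0 = c} = wordCylinder [c] :=
      Set.ext fun ξ => Boundary.mem_singleton_iff.symm
    rw [this]
    exact uniformMeasure_wordCylinder_ne_zero (by simp) (by simp)
  -- The word of `f ^ (-5)` followed by `b` is reduced, and `f ^ 5` maps its cylinder into that of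
  -- `b`; this makes the middle factor positive.
  have hr := isReduced_inv_append_letter (toWord_pow_succ ha hz haz 4).2 hb
  have ht : uniformMeasure α (translate (f ^ 5) ⁻¹' {ξ | ξ.letter 0 = b}) ≠ 0 := by
    refine fun h => uniformMeasure_wordCylinder_ne_zero hr (by simp)
      (measure_mono_null (fun ξ hξ => ?_) h)
    have := translate_inv_mem_wordCylinder hξ
    rw [inv_inv] at this
    exact Boundary.mem_singleton_iff.1 this
  exact (ENNReal.div_ne_zero.2 ⟨mul_ne_zero (mul_ne_zero baseDensity_ne_zero ht)
    (mul_ne_zero (hl b) (hl b')), ENNReal.ofNat_ne_top⟩)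

/-- The hypothesis splits `C × C'` into pairs whose line from `ξ` to `f ^ 5 * ζ` meets the
saturation `W` of `V` and pairs whose line from `ζ` to `ξ` does. The current of either family of
lines is at most that of `V`; converting back to product measure costs the factor `ρ` for the first
family. -/
theorem axisBound_le [Fintype α] {f : FreeGroup α} {a z b b' : α × Bool}
    (ha : f.toWord.head? = some a) (hz : f⁻¹.toWord.head? = some z) (haz : a ≠ z)
    (hb : b ≠ a) (hbz : b ≠ z) (hb' : b' ≠ a) (hbz' : b' ≠ z) (hbb : b ≠ b')
    {V : Set (DoubleBoundary α)} (hV : MeasurableSet V)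
    (h : ∀ p q : DoubleBoundary α, p.1.1.letter 0 = b → q.1.1.letter 0 = b' → q.1.2 = p.1.1 →
      p.1.2 = translate (f ^ 5) q.1.1 →
      ∃ t : ℤ, lineTranslate (f ^ t) p ∈ V ∨ lineTranslate (f ^ t) q ∈ V) :
    axisBound f b b' ≤ uniformCurrent α V := by
  have : Nonempty α := ⟨a.1⟩
  set μ := uniformMeasure α with hμ
  set η := uniformCurrent α with hη
  set κ := baseDensity α with hκ
  set ρ := μ (translate (f ^ 5) ⁻¹' {ξ | ξ.letter 0 = b}) with hρ
  set C : Set (Boundary α) := {ξ | ξ.letter 0 = b} with hC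
  set C' : Set (Boundary α) := {ξ | ξ.letter 0 = b'} with hC'
  have hCm : MeasurableSet C := measurableSet_letter b
  have hCm' : MeasurableSet C' := measurableSet_letter b'
  set W := ⋃ t : ℤ, lineTranslate (f ^ t) ⁻¹' V with hW
  have hWm : MeasurableSet W := MeasurableSet.iUnion fun t => measurable_lineTranslate _ hV
  have hWm' : MeasurableSet (Subtype.val '' W) := measurableEmbedding_val.measurableSet_image.2 hWm
  have htm : ∀ g : FreeGroup α, Measurable (translate g) :=
    fun g => (continuous_translate g).measurable
  have hlet : ∀ ζ : Boundary α, ζ.letter 0 = b' → (translate (f ^ 5) ζ).letter 0 = a :=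
    fun ζ hζ => letter_translate_pow ha hz haz (by rwa [hζ]) 4
  have hUV : ∀ U : Set (DoubleBoundary α), (∀ c : α × Bool, c ≠ a → c ≠ z →
      (∀ p ∈ U, p.1.1.letter 0 = c) → MeasurableSet U → η (W ∩ U) ≤ η V) := by
    intro U c hca hcz hUc hU
    -- By ping-pong, a nontrivial power of `f` changes the first letter `c` of the first end into
    -- `a` or `z`, so it moves `p` out of `U`.
    refine measure_iUnion_inter_le f hV hU fun p hp t ht hp' => ?_
    have h1 := hUc _ hp'
    rw [lineTranslate_fst] at h1
    rcases letter_translate_zpow ha hz haz (by rwa [hUc p hp]) (by rwa [hUc p hp]) ht with h2 | h2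
    · exact hca (h1.symm.trans h2)
    · exact hcz (h1.symm.trans h2)
  set D := translate (f ^ 5)⁻¹ ⁻¹' C' with hD
  have hDm : MeasurableSet D := htm _ hCm'
  have hDa : ∀ ζ ∈ D, ζ.letter 0 = a := by
    intro ζ hζ
    have := hlet _ hζ
    rwa [translate_translate_inv] at this
  have hCD : ∀ ξ ∈ C, ∀ ζ ∈ D, ξ.letter 0 ≠ ζ.letter 0 := by
    intro ξ hξ ζ hζ
    rw [hDa ζ hζ, show ξ.letter 0 = b from hξ]
    exact hb
  have hCC : ∀ ξ ∈ C', ∀ ζ ∈ C, ξ.letter 0 ≠ ζ.letter 0 := by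
    intro ξ hξ ζ hζ
    rw [show ξ.letter 0 = b' from hξ, show ζ.letter 0 = b from hζ]
    exact hbb.symm
  have hmE : ∀ (A B : Set (Boundary α)), MeasurableSet A → MeasurableSet B →
      (∀ ξ ∈ A, ∀ ζ ∈ B, ξ.letter 0 ≠ ζ.letter 0) →
      κ * (μ.prod μ) (Subtype.val '' W ∩ A ×ˢ B) = η (W ∩ rect A B) := by
    intro A B hA hB hAB
    rw [hη, uniformCurrent_eq_of_letter_ne (hWm.inter (measurableSet_rect hA hB))
      fun p hp => hAB _ hp.2.1 _ hp.2.2, Set.image_inter Subtype.val_injective, val_image_rect hAB]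
  set E := Subtype.val '' W ∩ C ×ˢ D with hE
  have hEm : MeasurableSet E := hWm'.inter (hCm.prod hDm)
  set Q := Subtype.val '' W ∩ C' ×ˢ C with hQ
  have hQm : MeasurableSet Q := hWm'.inter (hCm'.prod hCm)
  have hEV : κ * (μ.prod μ) E ≤ η V := by
    rw [hmE C D hCm hDm hCD]
    exact hUV _ b hb hbz (fun p hp => hp.1) (measurableSet_rect hCm hDm)
  have hQV : κ * (μ.prod μ) Q ≤ η V := by
    rw [hmE C' C hCm' hCm hCC]
    exact hUV _ b' hb' hbz' (fun p hp => hp.1) (measurableSet_rect hCm' hCm)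
  set P : Set (Boundary α × Boundary α) :=
    (fun x => (x.1, translate (f ^ 5) x.2)) ⁻¹' E with hP
  have hPm : MeasurableSet P :=
    (measurable_fst.prodMk ((htm _).comp measurable_snd)) hEm
  have hPE : ρ * (μ.prod μ) P ≤ (μ.prod μ) E := by
    have hz5 : (f ^ 5)⁻¹.toWord.head? = some z := by
      rw [← inv_pow]
      exact (toWord_pow_succ hz (by rwa [inv_inv]) haz.symm 4).2
    -- A section of `E` is the image under `f ^ 5` of that of `P`. By proportionality `ρ` times the
    -- measure of the latter is `μ C` times that of the former, and `μ C ≤ 1`.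
    have hsec : ∀ ξ, ρ * μ (Prod.mk ξ ⁻¹' P) ≤ μ (Prod.mk ξ ⁻¹' E) := by
      intro ξ
      have hsm : MeasurableSet (Prod.mk ξ ⁻¹' P) := measurable_prodMk_left hPm
      rw [hρ, hC, ← uniformMeasure_translate (toWord_pow_succ ha hz haz 4).2 hz5 hb hbz' hsm ?_]
      · have e : translate (f ^ 5)⁻¹ ⁻¹' (Prod.mk ξ ⁻¹' P) = Prod.mk ξ ⁻¹' E := by
          ext ζ
          simp only [hP, Set.mem_preimage]
          rw [translate_translate_inv]
        rw [e]
        exact mul_le_of_le_one_left' (uniformMeasure_le_one _)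
      · intro ζ hζ
        have : translate (f ^ 5) ζ ∈ D := hζ.2.2
        rw [hD, Set.mem_preimage, translate_inv_translate] at this
        exact this
    rw [Measure.prod_apply hPm, Measure.prod_apply hEm,
      ← lintegral_const_mul _ (measurable_measure_prodMk_left hPm)]
    exact lintegral_mono hsec
  have hcover : C ×ˢ C' ⊆ P ∪ Prod.swap ⁻¹' Q := by
    rintro ⟨ξ, ζ⟩ ⟨hξ, hζ⟩
    have hζ' : translate (f ^ 5) ζ ∈ D := by
      rw [hD, Set.mem_preimage, translate_inv_translate]
      exact hζ
    obtain ⟨t, ht⟩ := h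
      ⟨(ξ, translate (f ^ 5) ζ), fun e => hCD ξ hξ _ hζ' (congrArg (·.letter 0) e)⟩
      ⟨(ζ, ξ), fun e => hCC ζ hζ ξ hξ (congrArg (·.letter 0) e)⟩ hξ hζ rfl rfl
    rcases ht with ht | ht
    · exact Or.inl ⟨⟨_, Set.mem_iUnion.2 ⟨t, ht⟩, rfl⟩, hξ, hζ'⟩
    · exact Or.inr ⟨⟨_, Set.mem_iUnion.2 ⟨t, ht⟩, rfl⟩, hζ, hξ⟩
  have hswap : (μ.prod μ) (Prod.swap ⁻¹' Q) = (μ.prod μ) Q := by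
    rw [← Measure.map_apply measurable_swap hQm, Measure.prod_swap]
  have hmass : μ C * μ C' ≤ (μ.prod μ) P + (μ.prod μ) Q := by
    rw [← Measure.prod_prod, ← hswap]
    exact (measure_mono hcover).trans (measure_union_le _ _)
  refine ENNReal.div_le_of_le_mul ?_
  -- In the `P` term `ρ` is spent on passing to `E`; in the `Q` term it is dropped, as `ρ ≤ 1`. The
  -- two families give the `2` of `axisBound`.
  calc κ * ρ * (μ C * μ C') ≤ κ * ρ * ((μ.prod μ) P + (μ.prod μ) Q) := by gcongr
    _ = κ * (ρ * (μ.prod μ) P) + ρ * (κ * (μ.prod μ) Q) := by ring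
    _ ≤ κ * (μ.prod μ) E + κ * (μ.prod μ) Q := by
        refine add_le_add (by gcongr) ?_
        exact mul_le_of_le_one_left' (uniformMeasure_le_one (α := α) _)
    _ ≤ η V * 2 := by
        rw [mul_two]
        exact add_le_add hEV hQV

end LowerBound

/-! ### Proper powers, rotations of words, and disjoint translates inside the base-ball. -/

section Disjoint

variable {α : Type*}

/-- Euclid's algorithm on the lengths: of two commuting words the shorter is a prefix of the longer,
and it commutes with the rest. -/
theorem exists_common_root {β : Type*} : ∀ (n : ℕ) (x y : List β), x.length + y.length ≤ n →
    x ++ y = y ++ x → ∃ (w : List β) (i j : ℕ), x = (List.replicate i w).flatten ∧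
      y = (List.replicate j w).flatten
  | 0, x, y, hn, _ => by
    have hx : x = [] := List.length_eq_zero_iff.1 (by omega)
    have hy : y = [] := List.length_eq_zero_iff.1 (by omega)
    exact ⟨[], 0, 0, by simp [hx], by simp [hy]⟩
  | n + 1, x, y, hn, h => by
    rcases eq_or_ne x [] with rfl | hx
    · exact ⟨y, 0, 1, by simp, by simp⟩
    rcases eq_or_ne y [] with rfl | hy
    · exact ⟨x, 1, 0, by simp, by simp⟩
    have hxl := List.length_pos_iff.2 hx
    have hyl := List.length_pos_iff.2 hy
    rcases le_total x.length y.length with hl | hl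
    · obtain ⟨t, rfl⟩ := List.prefix_of_prefix_length_le (List.prefix_append x y)
        (h ▸ List.prefix_append y x) hl
      rw [List.append_assoc] at h
      have h' := List.append_cancel_left h
      obtain ⟨w, i, j, h1, h2⟩ := exists_common_root n x t
        (by rw [List.length_append] at hn; omega) h'
      refine ⟨w, i, i + j, h1, ?_⟩
      rw [List.replicate_add, List.flatten_append, ← h1, ← h2]
    · obtain ⟨t, rfl⟩ := List.prefix_of_prefix_length_le (List.prefix_append y x)
        (h ▸ List.prefix_append x y) hl
      rw [List.append_assoc] at h
      have h' := List.append_cancel_left h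
      obtain ⟨w, i, j, h1, h2⟩ := exists_common_root n t y
        (by rw [List.length_append] at hn; omega) h'
      refine ⟨w, j + i, j, ?_, h2⟩
      rw [List.replicate_add, List.flatten_append, ← h1, ← h2]

theorem mk_flatten_replicate (n : ℕ) (w : List (α × Bool)) :
    FreeGroup.mk (List.replicate n w).flatten = FreeGroup.mk w ^ n := by
  induction n with
  | zero => simp [FreeGroup.one_eq_mk]
  | succ n ih =>
    rw [List.replicate_succ, List.flatten_cons, ← FreeGroup.mul_mk, ih, pow_succ']

/-- An element of a free group that is not a proper power. -/
def IsRootFree (g : FreeGroup α) : Prop := ∀ (r : FreeGroup α) (n : ℕ), 2 ≤ n → r ^ n ≠ g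

theorem IsRootFree.map {g : FreeGroup α} (hg : IsRootFree g) (Φ : FreeGroup α ≃* FreeGroup α) :
    IsRootFree (Φ g) := by
  intro r n hn h
  refine hg (Φ.symm r) n hn ?_
  rw [← map_pow, h, MulEquiv.symm_apply_apply]

variable [DecidableEq α]

/-- The cyclic rotations of the word of an element that is not a proper power are distinct. -/
theorem IsRootFree.rotation_ne {g : FreeGroup α} (hg : IsRootFree g) {i j : ℕ} (hij : i < j)
    (hj : j < g.toWord.length) :
    g.toWord.drop i ++ g.toWord.take i ≠ g.toWord.drop j ++ g.toWord.take j := by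
  intro h
  set u := g.toWord.take i with hu
  set v := g.toWord.drop j with hv
  set x := (g.toWord.take j).drop i with hx
  have hj' : g.toWord.take j = u ++ x := by
    conv_lhs => rw [← List.take_append_drop i (g.toWord.take j), List.take_take,
      min_eq_left hij.le]
  have hgw : g.toWord = u ++ x ++ v := by rw [← hj', hv, List.take_append_drop]
  have hi' : g.toWord.drop i = x ++ v := by
    have hul : u.length = i := by rw [hu, List.length_take]; omega
    rw [hgw, List.append_assoc, ← hul, List.drop_left]
  have hxl : x.length = j - i := by rw [hx, List.length_drop, List.length_take]; omega
  have hvl : v.length = g.toWord.length - j := by rw [hv, List.length_drop]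
  rw [hi', hj', List.append_assoc, ← List.append_assoc v u x] at h
  -- With `g = u x v`, the equality of rotations says that `x` commutes with `v u`. Both are then
  -- positive powers of one word `w`, and `g = u (x v u) u⁻¹` is the power `m + n ≥ 2` of `u w u⁻¹`.
  obtain ⟨w, m, n, h1, h2⟩ := exists_common_root _ x (v ++ u) le_rfl h
  have hm : m ≠ 0 := by
    rintro rfl
    simp only [List.replicate_zero, List.flatten_nil] at h1
    rw [h1, List.length_nil] at hxl
    omega
  have hn : n ≠ 0 := by
    rintro rfl
    have := congrArg List.length h2
    simp only [List.replicate_zero, List.flatten_nil, List.length_append, List.length_nil] at this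
    omega
  refine hg (FreeGroup.mk u * FreeGroup.mk w * (FreeGroup.mk u)⁻¹) (m + n) (by omega) ?_
  rw [conj_pow, pow_add, ← mk_flatten_replicate, ← mk_flatten_replicate, ← h1, ← h2,
    ← FreeGroup.mul_mk]
  conv_rhs => rw [← FreeGroup.mk_toWord (x := g), hgw, ← FreeGroup.mul_mk, ← FreeGroup.mul_mk]
  group

theorem mem_baseBall_of_letter_ne {p : DoubleBoundary α}
    (h : p.1.1.letter 0 ≠ p.1.2.letter 0) : p ∈ baseBall := by
  obtain ⟨γ, hγ, h1, -⟩ := exists_geodesicLine p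
  refine ⟨γ, hγ, 0, 0, le_rfl, ?_, ?_⟩ <;>
  · have := h1 0
    rw [commonLength_eq_zero h] at this
    simpa [Boundary.initial, FreeGroup.one_eq_mk] using this

theorem measurableSet_axisCylinder (g : FreeGroup α) (a : α × Bool) :
    MeasurableSet (axisCylinder g a) :=
  measurableSet_rect (measurableSet_letter a).compl (measurableSet_wordCylinder _)

/-- The translated line runs from `1` through the prefix of length `j` and on, so the original line
passes through `1`. Two periods were required in `axisCylinder` so that a complete rotation of `g`
remains readable after `j` letters are removed. -/
theorem mem_of_lineTranslate_mem_axisCylinder [Finite α] {g : FreeGroup α} {a : α × Bool}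
    (ha : g.toWord.head? = some a) {j : ℕ} (hj : j < g.toWord.length) {p : DoubleBoundary α}
    (hp : lineTranslate (FreeGroup.mk (g.toWord.take j)) p ∈ axisCylinder g a) :
    p ∈ baseBall ∧ p.1.2 ∈ wordCylinder (g.toWord.drop j ++ g.toWord.take j) := by
  set u := FreeGroup.mk (g.toWord.take j) with hu
  have hred : FreeGroup.IsReduced g.toWord := FreeGroup.isReduced_toWord
  have huw : u.toWord = g.toWord.take j := toWord_mk_of_isReduced (hred.take j)
  obtain ⟨h1, h2⟩ := hp
  rw [lineTranslate_fst] at h1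
  rw [lineTranslate_snd] at h2
  have h3 : p.1.2 ∈ wordCylinder (g.toWord.drop j ++ g.toWord) := by
    have := translate_inv_mem_wordCylinder (h := u) (v := g.toWord.drop j ++ g.toWord)
      (by rwa [huw, ← List.append_assoc, List.take_append_drop])
    rwa [translate_inv_translate] at this
  have h4 : p.1.2 ∈ wordCylinder (g.toWord.drop j ++ g.toWord.take j) := by
    rw [show g.toWord.drop j ++ g.toWord =
      g.toWord.drop j ++ g.toWord.take j ++ g.toWord.drop j by simp] at h3
    exact wordCylinder_append_subset _ _ h3
  refine ⟨mem_baseBall_of_letter_ne ?_, h4⟩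
  have hl : p.1.2.letter 0 = g.toWord[j] := by
    refine Boundary.letter_eq_of_mem h3 ?_
    rw [List.drop_eq_getElem_cons hj]
    rfl
  rw [hl]
  rcases Nat.eq_zero_or_pos j with rfl | hj0
  · have : u = 1 := by simp [hu, FreeGroup.one_eq_mk]
    rw [this, translate_one] at h1
    have h5 : g.toWord[0] = a := by
      rw [List.head?_eq_getElem?, List.getElem?_eq_getElem hj] at ha
      simpa using ha
    rw [h5]
    exact h1
  -- For `j > 0` the first end starts with the inverse of letter `j - 1` of `g`, while the second
  -- starts with letter `j`; they differ because `g` is reduced.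
  · have h5 : u⁻¹.toWord.head? = some ((g.toWord[j - 1]).1, !(g.toWord[j - 1]).2) := by
      have h6 : g.toWord.take j = g.toWord.take (j - 1) ++ [g.toWord[j - 1]] := by
        rw [List.take_append_getElem, Nat.sub_add_cancel hj0]
      rw [FreeGroup.toWord_inv, huw, h6, FreeGroup.invRev_append]
      simp [FreeGroup.invRev]
    have hua : u.toWord.head? = some a := by
      rw [huw, List.head?_take]
      simp [ha, hj0.ne']
    have h6 := letter_translate h5 (ξ := translate u p.1.1) (by
      rw [inv_inv]
      exact fun h => h1 (Boundary.letter_eq_of_mem h hua))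
    rw [translate_inv_translate] at h6
    rw [h6]
    have h7 := List.isChain_iff_getElem.1 hred (j - 1) (by omega)
    simp only [show j - 1 + 1 = j by omega] at h7
    intro h8
    rw [← h8] at h7
    have h9 := h7 rfl
    revert h9
    cases (g.toWord[j - 1]).2 <;> simp

end Disjoint

/-! ### Comparison of word length with the length of an automorphism. -/

section Main

variable {α : Type*} [DecidableEq α]

theorem head?_ne_of_isCyclicallyReduced {g : FreeGroup α}
    (h : FreeGroup.IsCyclicallyReduced g.toWord) {a z : α × Bool}
    (ha : g.toWord.head? = some a) (hz : g⁻¹.toWord.head? = some z) : a ≠ z := by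
  rintro rfl
  rw [FreeGroup.toWord_inv] at hz
  have h1 : g.toWord.getLast? = some (a.1, !a.2) := by
    have : g.toWord = FreeGroup.invRev (FreeGroup.invRev g.toWord) := by simp
    obtain ⟨u, hu⟩ := List.head?_eq_some_iff.1 hz
    rw [this, hu]
    simp [FreeGroup.invRev]
  have := h.2 _ h1 _ ha rfl
  simp at this

theorem exists_head? {g : FreeGroup α} (h : g ≠ 1) : ∃ a, g.toWord.head? = some a := by
  rcases hg : g.toWord with _ | ⟨a, u⟩
  · exact absurd (FreeGroup.toWord_eq_nil_iff.1 hg) h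
  · exact ⟨a, rfl⟩

variable [Fintype α]

/-- This inequality holds for pushforwards of arbitrary sets, so the measurability of `baseBall` is
not needed. -/
theorem uniformCurrent_preimage_baseBall_le (Φ : FreeGroup α ≃* FreeGroup α) :
    uniformCurrent α (doubleBoundaryMap Φ ⁻¹' baseBall) ≤ automorphismLength Φ :=
  Measure.le_map_apply (measurable_doubleBoundaryMap Φ).aemeasurable _

/-- The base-ball contains one translate of `axisCylinder g a` for each of the `g.norm` proper
prefixes of `g`. Distinct rotations make them disjoint; equivariance of `Φ` and invariance of the
current give their preimages equal mass. -/
theorem norm_mul_le_automorphismLength (Φ : FreeGroup α ≃* FreeGroup α) {g : FreeGroup α}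
    (hg : IsRootFree g) {a : α × Bool} (ha : g.toWord.head? = some a) :
    (g.norm : ℝ≥0∞) * uniformCurrent α (doubleBoundaryMap Φ ⁻¹' axisCylinder g a) ≤
      automorphismLength Φ := by
  let A : ℕ → Set (DoubleBoundary α) := fun j =>
    lineTranslate (FreeGroup.mk (g.toWord.take j)) ⁻¹' axisCylinder g a
  have hAm : ∀ j, MeasurableSet (doubleBoundaryMap Φ ⁻¹' A j) := fun j =>
    measurable_doubleBoundaryMap Φ (measurable_lineTranslate _ (measurableSet_axisCylinder g a))
  have hA : ∀ j, uniformCurrent α (doubleBoundaryMap Φ ⁻¹' A j) =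
      uniformCurrent α (doubleBoundaryMap Φ ⁻¹' axisCylinder g a) := by
    intro j
    rw [← uniformCurrent_lineTranslate_preimage (Φ.symm (FreeGroup.mk (g.toWord.take j)))
      (measurable_doubleBoundaryMap Φ (measurableSet_axisCylinder g a))]
    congr 1
    ext p
    simp only [A, Set.mem_preimage, doubleBoundaryMap_lineTranslate, MulEquiv.apply_symm_apply]
  have hlt : ∀ i ∈ Finset.range g.norm, i < g.toWord.length := fun i hi => Finset.mem_range.1 hi
  have hdisj : ∀ i j, i < j → j < g.toWord.length → Disjoint (A i) (A j) := by
    intro i j hij hj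
    refine Set.disjoint_left.2 fun p hpi hpj => hg.rotation_ne hij hj ?_
    have h1 := (mem_of_lineTranslate_mem_axisCylinder ha (hij.trans hj) hpi).2
    have h2 := (mem_of_lineTranslate_mem_axisCylinder ha hj hpj).2
    rw [mem_wordCylinder_iff] at h1 h2
    rw [← h1, ← h2]
    congr 1
    simp only [List.length_append, List.length_drop, List.length_take]
    omega
  have hsum : (g.norm : ℝ≥0∞) * uniformCurrent α (doubleBoundaryMap Φ ⁻¹' axisCylinder g a) =
      uniformCurrent α (⋃ j ∈ Finset.range g.norm, doubleBoundaryMap Φ ⁻¹' A j) := by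
    rw [measure_biUnion_finset ?_ fun j _ => hAm j, Finset.sum_congr rfl fun j _ => hA j,
      Finset.sum_const, Finset.card_range, nsmul_eq_mul]
    intro i hi j hj hij
    refine Disjoint.preimage _ ?_
    rcases lt_or_gt_of_ne hij with h | h
    · exact hdisj i j h (hlt j hj)
    · exact (hdisj j i h (hlt i hi)).symm
  rw [hsum]
  refine (measure_mono (Set.iUnion₂_subset fun j hj => Set.preimage_mono fun p hp => ?_)).trans
    (uniformCurrent_preimage_baseBall_le Φ)
  exact (mem_of_lineTranslate_mem_axisCylinder ha (hlt j hj) hp).1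

/-- Rank at least 2 means at least four letters, so two remain besides the first letters of `f` and
`f⁻¹`. -/
theorem exists_two_letters (h : 2 ≤ Fintype.card α) (a z : α × Bool) :
    ∃ b b' : α × Bool, b ≠ a ∧ b ≠ z ∧ b' ≠ a ∧ b' ≠ z ∧ b ≠ b' := by
  have h1 : 1 < (Finset.univ \ {a, z} : Finset (α × Bool)).card := by
    have h2 := Finset.le_card_sdiff {a, z} (Finset.univ : Finset (α × Bool))
    have h3 := Finset.card_le_two (a := a) (b := z)
    rw [Finset.card_univ, Fintype.card_prod, Fintype.card_bool] at h2
    omega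
  obtain ⟨b, hb, b', hb', hne⟩ := Finset.one_lt_card.1 h1
  simp only [Finset.mem_sdiff, Finset.mem_insert, Finset.mem_singleton, not_or] at hb hb'
  exact ⟨b, b', hb.2.1, hb.2.2, hb'.2.1, hb'.2.2, hne⟩

/-- The cyclically reduced length of the image of a fixed element is at most a constant times the
length of the automorphism. -/
theorem exists_norm_mul_le_automorphismLength (hα : 2 ≤ Fintype.card α) {f : FreeGroup α}
    (hf : FreeGroup.IsCyclicallyReduced f.toWord) (hf1 : f ≠ 1) (hr : IsRootFree f) :
    ∃ c : ℝ≥0∞, c ≠ 0 ∧ ∀ Φ : FreeGroup α ≃* FreeGroup α,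
      FreeGroup.IsCyclicallyReduced (Φ f).toWord →
      ((Φ f).norm : ℝ≥0∞) * c ≤ automorphismLength Φ := by
  obtain ⟨a, ha⟩ := exists_head? hf1
  obtain ⟨z, hz⟩ := exists_head? (inv_ne_one.2 hf1)
  have haz := head?_ne_of_isCyclicallyReduced hf ha hz
  obtain ⟨b, b', hba, hbz, hba', hbz', hbb⟩ := exists_two_letters hα a z
  refine ⟨axisBound f b b', axisBound_ne_zero ha hz haz hba, fun Φ hΦ => ?_⟩
  have hΦ1 : Φ f ≠ 1 := by simpa using hf1
  obtain ⟨a₁, ha₁⟩ := exists_head? hΦ1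
  obtain ⟨z₁, hz₁⟩ := exists_head? (inv_ne_one.2 hΦ1)
  have haz₁ := head?_ne_of_isCyclicallyReduced hΦ ha₁ hz₁
  refine le_trans ?_ (norm_mul_le_automorphismLength Φ (hr.map Φ) ha₁)
  gcongr
  refine axisBound_le ha hz haz hba hbz hba' hbz' hbb
    (measurable_doubleBoundaryMap Φ (measurableSet_axisCylinder _ _)) ?_
  intro p q hp hq hqp hpq
  -- `f` moves such a ray to one starting with `a`, so it does not fix it; equivariance transfers
  -- this to `Φ f`. Hence the images are not ends of the axis of `Φ f`.
  have hfix : ∀ ξ : Boundary α, ξ.letter 0 ≠ a → ξ.letter 0 ≠ z →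
      translate (Φ f) (boundaryMap Φ ξ) ≠ boundaryMap Φ ξ := by
    intro ξ h1 h2 h
    rw [← boundaryMap_translate] at h
    have h3 := boundaryMap_injective Φ h
    have h4 := letter_translate_of_ne ha hz h2
    rw [h3] at h4
    exact h1 h4
  obtain ⟨t, ht⟩ := exists_lineTranslate_mem_axisCylinder ha₁ hz₁ haz₁
    (p := doubleBoundaryMap Φ p) (q := doubleBoundaryMap Φ q)
    (hfix _ (by rwa [hp]) (by rwa [hp])) (hfix _ (by rwa [hq]) (by rwa [hq]))
    (congrArg (boundaryMap Φ) hqp)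
    (by
      change boundaryMap Φ p.1.2 = translate _ (boundaryMap Φ q.1.1)
      rw [hpq, boundaryMap_translate, map_pow])
  refine ⟨t, ?_⟩
  simpa only [Set.mem_preimage, doubleBoundaryMap_lineTranslate, map_zpow] using ht

/-- The length of an automorphism depends only on its outer class. -/
theorem automorphismLength_conj_mul (x : FreeGroup α) (Φ : FreeGroup α ≃* FreeGroup α) :
    automorphismLength (Φ.trans (MulAut.conj x)) = automorphismLength Φ := by
  -- On the boundary, conjugating by `x` after `Φ` amounts to translating by `Φ.symm x` before it,
  -- and the uniform current absorbs that translation.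
  have e : doubleBoundaryMap (Φ.trans (MulAut.conj x)) =
      doubleBoundaryMap Φ ∘ lineTranslate (Φ.symm x) := by
    funext p
    have hb : ∀ ξ : Boundary α, boundaryMap (Φ.trans (MulAut.conj x)) ξ =
        boundaryMap Φ (translate (Φ.symm x) ξ) := by
      intro ξ
      rw [boundaryMap_translate, MulEquiv.apply_symm_apply]
      have h1 := boundaryMap_spec (Φ.trans (MulAut.conj x)) (convergesTo_vertex ξ)
      have h2 := boundaryMap_spec (MulAut.conj x) (boundaryMap_spec Φ (convergesTo_vertex ξ))
      exact h1.unique h2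
    exact Subtype.ext (Prod.ext (hb _) (hb _))
  rw [automorphismLength, automorphismLength, e, ← Measure.map_map
    (measurable_doubleBoundaryMap Φ) (measurable_lineTranslate _),
    map_lineTranslate_uniformCurrent]

end Main

/-! ### Cyclically reduced length and the reduction to elements that are not proper powers. -/

section CyclicLength

variable {α : Type*} [DecidableEq α]

theorem reduceCyclically_eq_self {L : List (α × Bool)} (h : FreeGroup.IsCyclicallyReduced L) :
    FreeGroup.reduceCyclically L = L := by
  induction L using List.bidirectionalRec with
  | nil => simp
  | singleton a => simp
  | cons_append a L b _ =>
    rw [FreeGroup.reduceCyclically.cons_append, if_neg]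
    · simp
    · rintro ⟨h1, h2⟩
      have := (FreeGroup.isCyclicallyReduced_cons_append_iff.1 h).2 h1
      rw [this] at h2
      simp at h2

theorem reduceCyclically_conj (c L : List (α × Bool)) :
    FreeGroup.reduceCyclically (c ++ L ++ FreeGroup.invRev c) =
      FreeGroup.reduceCyclically L := by
  induction c with
  | nil => simp
  | cons a c ih =>
    have : a :: c ++ L ++ FreeGroup.invRev (a :: c) =
        a :: ((c ++ L ++ FreeGroup.invRev c) ++ [(a.1, !a.2)]) := by
      rw [FreeGroup.invRev_cons]
      simp [FreeGroup.invRev]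
    rw [this, FreeGroup.reduceCyclically.cons_append, if_pos (by simp), ih]

/-- Write `x` as a conjugate of its cyclically reduced core. Powers of the core are again cyclically
reduced words, so its length is multiplied by `n`. -/
theorem cyclicLength_pow (x : FreeGroup α) (n : ℕ) :
    cyclicLength (x ^ n) = n * cyclicLength x := by
  rcases Nat.eq_zero_or_eq_succ_pred n with rfl | h
  · simp [cyclicLength]
  · have hx : FreeGroup.IsReduced x.toWord := FreeGroup.isReduced_toWord
    rw [h, cyclicLength, FreeGroup.toWord_pow,
      FreeGroup.reduceCyclically.reduce_flatten_replicate_succ hx, reduceCyclically_conj,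
      reduceCyclically_eq_self
        ((FreeGroup.reduceCyclically.isCyclicallyReduced hx).flatten_replicate _)]
    simp [cyclicLength]

/-- Every element is conjugate to one with a cyclically reduced word. -/
theorem exists_conj_isCyclicallyReduced (g : FreeGroup α) :
    ∃ w g₀ : FreeGroup α, g = w * g₀ * w⁻¹ ∧ FreeGroup.IsCyclicallyReduced g₀.toWord ∧
      g₀.norm = cyclicLength g := by
  have h := FreeGroup.reduceCyclically.isCyclicallyReduced
    (FreeGroup.isReduced_toWord (x := g))
  have e := toWord_mk_of_isReduced h.isReduced
  refine ⟨FreeGroup.mk (FreeGroup.reduceCyclically.conjugator g.toWord),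
    FreeGroup.mk (FreeGroup.reduceCyclically g.toWord), ?_, by rwa [e], by
      rw [FreeGroup.norm, e, cyclicLength]⟩
  rw [FreeGroup.inv_mk, FreeGroup.mul_mk, FreeGroup.mul_mk,
    FreeGroup.reduceCyclically.conj_conjugator_reduceCyclically, FreeGroup.mk_toWord]

theorem one_le_cyclicLength {g : FreeGroup α} (h : g ≠ 1) : 1 ≤ cyclicLength g := by
  obtain ⟨w, g₀, h1, -, h2⟩ := exists_conj_isCyclicallyReduced g
  by_contra! h3
  rw [Nat.lt_one_iff, ← h2, FreeGroup.norm_eq_zero] at *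
  rw [h3] at h1
  exact h (by simpa using h1)

theorem cyclicLength_le_norm (g : FreeGroup α) : cyclicLength g ≤ g.norm := by
  have := congrArg List.length
    (FreeGroup.reduceCyclically.conj_conjugator_reduceCyclically g.toWord)
  simp only [List.length_append] at this
  rw [cyclicLength, FreeGroup.norm]
  omega

/-- Automorphisms of free groups of rank at most one preserve the word length. -/
theorem norm_map_of_subsingleton [Subsingleton α] (Φ : FreeGroup α ≃* FreeGroup α)
    (f : FreeGroup α) : (Φ f).norm = f.norm := by
  rcases isEmpty_or_nonempty α with h | ⟨⟨a⟩⟩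
  · rw [Subsingleton.elim (Φ f) f]
  · have hgen : ∀ g : FreeGroup α, ∃ n : ℤ, g = FreeGroup.of a ^ n := by
      intro g
      induction g using FreeGroup.induction_on with
      | C1 => exact ⟨0, by simp⟩
      | of x => exact ⟨1, by rw [Subsingleton.elim x a, zpow_one]⟩
      | inv_of x _ => exact ⟨-1, by rw [Subsingleton.elim x a]; simp⟩
      | mul x y hx hy =>
        obtain ⟨m, hm⟩ := hx
        obtain ⟨n, hn⟩ := hy
        exact ⟨m + n, by rw [hm, hn, zpow_add]⟩
    obtain ⟨m, hm⟩ := hgen (Φ (FreeGroup.of a))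
    obtain ⟨n, hn⟩ := hgen (Φ.symm (FreeGroup.of a))
    obtain ⟨k, rfl⟩ := hgen f
    have hmn : FreeGroup.of a ^ (m * n) = FreeGroup.of a ^ (1 : ℤ) := by
      rw [zpow_mul, ← hm, ← map_zpow, ← hn, MulEquiv.apply_symm_apply, zpow_one]
    -- The generator has infinite order, so exponents can be compared; the automorphism is the
    -- identity or inversion.
    have hmn' : m * n = 1 := injective_zpow_iff_not_isOfFinOrder.2
      (not_isOfFinOrder_of_isMulTorsionFree (FreeGroup.of_ne_one a)) hmn
    rcases Int.eq_one_or_neg_one_of_mul_eq_one hmn' with rfl | rfl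
    · rw [map_zpow, hm, zpow_one]
    · rw [map_zpow, hm, zpow_neg_one, inv_zpow, FreeGroup.norm_inv_eq]

/-- Cyclically reducing `f` costs one fixed conjugation. Cyclically reducing `Φ n f` costs an inner
automorphism depending on `n`, which does not change the length of the automorphism. -/
theorem exists_cyclicLength_lt_of_isRootFree [Fintype α] (hα : 2 ≤ Fintype.card α)
    {ι : Type*} (Φ : ι → (FreeGroup α ≃* FreeGroup α)) (M : ℝ≥0)
    (hM : ∀ n, automorphismLength (Φ n) < (M : ℝ≥0∞)) {f : FreeGroup α} (hf : f ≠ 1)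
    (hr : IsRootFree f) : ∃ m : ℕ, ∀ n, cyclicLength (Φ n f) < m := by
  obtain ⟨v, f₀, hv, hf₀, -⟩ := exists_conj_isCyclicallyReduced f
  have hf₀1 : f₀ ≠ 1 := by
    rintro rfl
    exact hf (by simpa using hv)
  have hr₀ : IsRootFree f₀ := by
    intro r n hn h
    exact hr (v * r * v⁻¹) n hn (by rw [conj_pow, h, hv])
  obtain ⟨c, hc, hle⟩ := exists_norm_mul_le_automorphismLength hα hf₀ hf₀1 hr₀
  have hfin : (M : ℝ≥0∞) / c ≠ ∞ := ENNReal.div_ne_top ENNReal.coe_ne_top hc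
  obtain ⟨m, hm⟩ := ENNReal.exists_nat_gt hfin
  refine ⟨m, fun n => ?_⟩
  obtain ⟨w, g, hw, hg, hgn⟩ := exists_conj_isCyclicallyReduced (Φ n f)
  -- From `f = v f₀ v⁻¹` and `Φ n f = w g w⁻¹`, the element `w⁻¹ * Φ n v` conjugates `Φ n f₀` to
  -- `g`.
  have e : (Φ n).trans (MulAut.conj (w⁻¹ * Φ n v)) f₀ = g := by
    have h1 : Φ n f = Φ n v * Φ n f₀ * (Φ n v)⁻¹ := by
      rw [← map_inv, ← map_mul, ← map_mul, ← hv]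
    rw [h1] at hw
    have h2 : g = w⁻¹ * (w * g * w⁻¹) * w := by group
    rw [h2, ← hw, MulEquiv.trans_apply, MulAut.conj_apply]
    group
  have h1 := hle ((Φ n).trans (MulAut.conj (w⁻¹ * Φ n v))) (by rwa [e])
  rw [e, automorphismLength_conj_mul, hgn] at h1
  have h2 : (cyclicLength (Φ n f) : ℝ≥0∞) ≤ M / c := by
    refine (ENNReal.le_div_iff_mul_le (.inl hc) (.inr ENNReal.coe_ne_top)).2 ?_
    exact h1.trans (hM n).le
  exact_mod_cast h2.trans_lt hm

/-- A nontrivial proper power `r ^ e` has a root of smaller cyclic length, and a bound for `r` times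
`e` is a bound for `r ^ e`. The identity is treated apart, being its own root. -/
theorem exists_cyclicLength_lt [Fintype α] (hα : 2 ≤ Fintype.card α)
    {ι : Type*} (Φ : ι → (FreeGroup α ≃* FreeGroup α)) (M : ℝ≥0)
    (hM : ∀ n, automorphismLength (Φ n) < (M : ℝ≥0∞)) (f : FreeGroup α) :
    ∃ m : ℕ, ∀ n, cyclicLength (Φ n f) < m := by
  induction h : cyclicLength f using Nat.strong_induction_on generalizing f with
  | _ k ih =>
    subst h
    rcases eq_or_ne f 1 with rfl | hf
    · exact ⟨1, fun n => by simp [cyclicLength]⟩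
    by_cases hr : IsRootFree f
    · exact exists_cyclicLength_lt_of_isRootFree hα Φ M hM hf hr
    · simp only [IsRootFree, not_forall, not_not] at hr
      obtain ⟨r, e, he, rfl⟩ := hr
      have hr1 : r ≠ 1 := by
        rintro rfl
        exact hf (one_pow e)
      have h1 := one_le_cyclicLength hr1
      obtain ⟨m, hm⟩ := ih (cyclicLength r) (by rw [cyclicLength_pow]; nlinarith) r rfl
      refine ⟨e * m, fun n => ?_⟩
      rw [map_pow, cyclicLength_pow]
      exact Nat.mul_lt_mul_of_pos_left (hm n) (by omega)

end CyclicLength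

end FreeGroupCurrent

/-- Automorphisms of the free group on a finite set `α` with uniformly bounded lengths have, on each
element of the group, uniformly bounded cyclically reduced lengths. -/
theorem corollary4p9 {α : Type*} [Fintype α] [DecidableEq α]
    (Φ : ℕ → (FreeGroup α ≃* FreeGroup α)) (M : ℝ≥0)
    (hM : ∀ n, FreeGroupCurrent.automorphismLength (Φ n) < (M : ℝ≥0∞)) :
    ∀ f : FreeGroup α, ∃ Mf : ℕ, ∀ n, FreeGroupCurrent.cyclicLength (Φ n f) < Mf := by
  intro f
  rcases le_or_gt 2 (Fintype.card α) with h | h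
  · exact FreeGroupCurrent.exists_cyclicLength_lt h Φ M hM f
  -- In rank at most 1 no bound on the lengths is needed: word length is preserved and dominates
  -- cyclic length.
  · have : Subsingleton α := Fintype.card_le_one_iff_subsingleton.1 (by omega)
    refine ⟨f.norm + 1, fun n => Nat.lt_succ_of_le ?_⟩
    rw [← FreeGroupCurrent.norm_map_of_subsingleton (Φ n) f]
    exact FreeGroupCurrent.cyclicLength_le_norm _
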